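/- Let $n\ge 4$, let $I\subset\mathbb R$ be an open interval, $f:I\to(0,\infty)$ a smooth function and $c\in\{-1,0,1\}$. Let $(\mathbb Q^n(c),h)$ be an $n$-dimensional Riemannian manifold of constant sectional curvature $c$ (for instance the complete, simply connected space form; completeness and simple connectedness are not needed), and let $I\times_f\mathbb Q^n(c)$ be the product manifold with the warped metric $\langle\,,\rangle=dt^2+f(t)^2h$. Let $\chi=(\pi,\chi_2):M^n\to I\times_f\mathbb Q^n(c)$ be a smooth immersed hypersurface with a smooth unit normal field $\mathcal N$; give $M$ the induced metric, let $A X=-(\bar\nabla_X\mathcal N)^{\top}$ be its shape operator, where $\bar\nabla$ is the Levi-Civita connection of $I\times_f\mathbb Q^n(c)$, $H=\frac1n\operatorname{tr}A$ its mean curvature, and let $T$ be the tangential part of the unit vector field $\partial_t$ along $M$, so that $\partial_t=T+\theta\mathcal N$ with $\theta=\langle\partial_t,\mathcal N\rangle$. Put $$a=\frac{(f')^2-c}{f^2},\qquad b=\frac{f''}{f}-\frac{(f')^2}{f^2}+\frac{c}{f^2},$$ evaluated along $M$ at $t=\pi$. Suppose that $M$ is Einstein, $\mathrm{Ric}=\rho\,\langle\,,\rangle$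 with a constant $\rho\in\mathbb R$, and that $T\neq0$ and $b\neq0$ at $x_0\in M$. Then, at $x_0$, $T$ is an eigenvector of $A$; write $AT=\lambda_nT$. Furthermore, $A$ has at least $2$ and at most $3$ distinct principal curvatures (eigenvalues) at $x_0$: they are $\lambda_n,\lambda_1,\lambda_2$ for some real numbers $\lambda_1,\lambda_2$ (possibly equal to each other) that are both different from $\lambda_n$, and $$\lambda_i^2-nH\lambda_i+\rho+(n-1)a+|T|^2b=0,\qquad i\in\{1,2\},$$ $$\lambda_n^2-nH\lambda_n+\rho+(n-1)\left(a+|T|^2b\right)=0.$$ In particular, the multiplicity of $\lambda_n$ as an eigenvalue of $A$ at $x_0$ is $1$. -/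

import Mathlib

set_option maxSynthPendingDepth 3

open scoped Manifold ContDiff
open Bundle

noncomputable section

namespace WarpedHypersurface

section Coordinates

/-! Levi-Civita connection and curvature of a metric tensor `G` given in coordinates,
that is, of a field of bilinear forms on (an open subset of) a vector space `E`. -/

variable {E : Type*} [NormedAddCommGroup E] [NormedSpace ℝ E]

/-- Christoffel symbols of the first kind:
`Γ_u(v, w; z) = ½ (D_v G(w, z) + D_w G(v, z) - D_z G(v, w))`. -/
def christoffelFirst (G : E → E →L[ℝ] E →L[ℝ] ℝ) (u : E) : E →L[ℝ] E →L[ℝ] E →L[ℝ] ℝ :=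
  let D : E →L[ℝ] E →L[ℝ] E →L[ℝ] ℝ := fderiv ℝ G u
  let S : (E →L[ℝ] E →L[ℝ] ℝ) →L[ℝ] (E →L[ℝ] E →L[ℝ] ℝ) :=
    (ContinuousLinearMap.flipₗᵢ ℝ E E ℝ).toContinuousLinearEquiv.toContinuousLinearMap
  let D' : E →L[ℝ] E →L[ℝ] E →L[ℝ] ℝ := S ∘L D.flip
  (1 / 2 : ℝ) • (D + D.flip - D')

theorem christoffelFirst_apply (G : E → E →L[ℝ] E →L[ℝ] ℝ) (u v w z : E) :
    christoffelFirst G u v w z =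
      1 / 2 * (fderiv ℝ G u v w z + fderiv ℝ G u w v z - fderiv ℝ G u z v w) :=
  rfl

/-- Christoffel symbols of the second kind: the vector `Γ_u(v, w)` with
`G_u(Γ_u(v, w), z) = Γ_u(v, w; z)` for all `z`. The Levi-Civita connection of `G` is
`∇_v Y = D_v Y + Γ(v, Y)`. -/
def christoffel (G : E → E →L[ℝ] E →L[ℝ] ℝ) (u : E) : E →L[ℝ] E →L[ℝ] E :=
  ContinuousLinearMap.compL ℝ E (E →L[ℝ] ℝ) E (G u).inverse ∘L christoffelFirst G u

theorem christoffel_apply (G : E → E →L[ℝ] E →L[ℝ] ℝ) (u v w : E) :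
    christoffel G u v w = (G u).inverse (christoffelFirst G u v w) :=
  rfl

/-- The endomorphism `v ↦ R(v, w) z`, where
`R(X, Y) Z = ∇_X ∇_Y Z - ∇_Y ∇_X Z - ∇_{[X, Y]} Z` is the curvature operator of `G` at `u`. -/
def curvature (G : E → E →L[ℝ] E →L[ℝ] ℝ) (u w z : E) : E →L[ℝ] E :=
  ((fderiv ℝ (christoffel G) u).flip w).flip z - (fderiv ℝ (christoffel G) u w).flip z
    + (christoffel G u).flip (christoffel G u w z)
    - christoffel G u w ∘L (christoffel G u).flip z

theorem curvature_apply (G : E → E →L[ℝ] E →L[ℝ] ℝ) (u v w z : E) :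
    curvature G u w z v =
      fderiv ℝ (christoffel G) u v w z - fderiv ℝ (christoffel G) u w v z
        + christoffel G u v (christoffel G u w z) - christoffel G u w (christoffel G u v z) :=
  rfl

end Coordinates

section Manifold

variable {E : Type*} [NormedAddCommGroup E] [NormedSpace ℝ E]
  {H : Type*} [TopologicalSpace H] (J : ModelWithCorners ℝ E H)
  {N : Type*} [TopologicalSpace N] [ChartedSpace H N]

/-- The expression of the metric tensor `g` in the preferred chart at `x`. -/
def chartMetric (g : ∀ y : N, TangentSpace J y →L[ℝ] TangentSpace J y →L[ℝ] ℝ) (x : N) (u : E) :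
    E →L[ℝ] E →L[ℝ] ℝ :=
  let L : E →L[ℝ] E := mfderiv 𝓘(ℝ, E) J (extChartAt J x).symm u
  let B : E →L[ℝ] E →L[ℝ] ℝ := g ((extChartAt J x).symm u)
  B.bilinearComp L L

/-- The endomorphism `v ↦ R(v, w) z` of the tangent space at `x`, computed in the preferred chart
at `x`, through which Mathlib identifies that tangent space with `E`. -/
def curvatureAt (g : ∀ y : N, TangentSpace J y →L[ℝ] TangentSpace J y →L[ℝ] ℝ) (x : N)
    (w z : TangentSpace J x) : TangentSpace J x →L[ℝ] TangentSpace J x :=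
  (curvature (chartMetric J g x) (extChartAt J x x) w z : E →L[ℝ] E)

/-- The Ricci tensor `Ric(w, z) = tr (v ↦ R(v, w) z)`. -/
def ricciAt (g : ∀ y : N, TangentSpace J y →L[ℝ] TangentSpace J y →L[ℝ] ℝ) (x : N)
    (w z : TangentSpace J x) : ℝ :=
  LinearMap.trace ℝ (TangentSpace J x) (curvatureAt J g x w z).toLinearMap

/-- `Ric = ρ g`. -/
def IsEinstein (g : ∀ y : N, TangentSpace J y →L[ℝ] TangentSpace J y →L[ℝ] ℝ) (ρ : ℝ) : Prop :=
  ∀ (x : N) (w z : TangentSpace J x), ricciAt J g x w z = ρ * g x w z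

/-- All sectional curvatures are equal to `c`. -/
def HasConstantSectionalCurvature
    (g : ∀ y : N, TangentSpace J y →L[ℝ] TangentSpace J y →L[ℝ] ℝ) (c : ℝ) : Prop :=
  ∀ (x : N) (v w : TangentSpace J x),
    g x (curvatureAt J g x w w v) v = c * (g x v v * g x w w - g x v w ^ 2)

end Manifold

section Immersion

variable {E : Type*} [NormedAddCommGroup E] [NormedSpace ℝ E]
  {H : Type*} [TopologicalSpace H] (I : ModelWithCorners ℝ E H)
  {M : Type*} [TopologicalSpace M] [ChartedSpace H M]
  {E' : Type*} [NormedAddCommGroup E'] [NormedSpace ℝ E']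
  {H' : Type*} [TopologicalSpace H'] (J : ModelWithCorners ℝ E' H')
  {N : Type*} [TopologicalSpace N] [ChartedSpace H' N]
  (g : ∀ y : N, TangentSpace J y →L[ℝ] TangentSpace J y →L[ℝ] ℝ) (χ : M → N)

/-- The metric induced on `M` by a map `χ : M → (N, g)`. -/
def inducedMetric (x : M) : TangentSpace I x →L[ℝ] TangentSpace I x →L[ℝ] ℝ :=
  let L : E →L[ℝ] E' := mfderiv I J χ x
  let B : E' →L[ℝ] E' →L[ℝ] ℝ := g (χ x)
  (B.bilinearComp L L : E →L[ℝ] E →L[ℝ] ℝ)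

/-- The tangential projection along the immersion `χ`: a vector `ξ` of `N` at `χ x` is sent to
the vector `X` of `M` at `x` such that `⟨dχ X, dχ w⟩ = ⟨ξ, dχ w⟩` for all `w`. -/
def tangentialPart (x : M) : TangentSpace J (χ x) →L[ℝ] TangentSpace I x :=
  let L : E →L[ℝ] E' := mfderiv I J χ x
  let B : E' →L[ℝ] E' →L[ℝ] ℝ := g (χ x)
  let G : E →L[ℝ] E →L[ℝ] ℝ := inducedMetric I J g χ x
  (G.inverse ∘L B.bilinearComp (ContinuousLinearMap.id ℝ E') L : E' →L[ℝ] E)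

/-- A smooth unit normal vector field along the immersion `χ`. -/
structure IsUnitNormal [IsManifold J 1 N] (ν : ∀ x : M, TangentSpace J (χ x)) : Prop where
  smooth : ContMDiff I J.tangent ∞ (fun x : M ↦ (⟨χ x, ν x⟩ : TangentBundle J N))
  unit : ∀ x, g (χ x) (ν x) (ν x) = 1
  normal : ∀ (x : M) (v : TangentSpace I x), g (χ x) (ν x) (mfderiv I J χ x v) = 0

/-- The covariant derivative `v ↦ ∇_v ν` at `x` of a vector field `ν` along `χ`, with respect to the
Levi-Civita connection of `(N, g)`. In the preferred charts at `x` and at `χ x` it is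
`∇_v V = D_v V + Γ(D_v F, V)`, where `F` represents `χ` and `V` represents `ν`. -/
def covariantDerivAlong (ν : ∀ x : M, TangentSpace J (χ x)) (x : M) :
    TangentSpace I x →L[ℝ] TangentSpace J (χ x) :=
  let u₀ : E := extChartAt I x x
  let F : E → E' := writtenInExtChartAt I J x χ
  let V : E → E' := fun u ↦
    mfderiv J 𝓘(ℝ, E') (extChartAt J (χ x)) (χ ((extChartAt I x).symm u))
      (ν ((extChartAt I x).symm u))
  (fderiv ℝ V u₀ + (christoffel (chartMetric J g (χ x)) (F u₀)).flip (V u₀) ∘L fderiv ℝ F u₀ :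
    E →L[ℝ] E')

/-- The shape operator `A v = -(∇_v ν)^⊤` associated with the unit normal field `ν`. -/
def shapeOperator (ν : ∀ x : M, TangentSpace J (χ x)) (x : M) :
    TangentSpace I x →L[ℝ] TangentSpace I x :=
  -(tangentialPart I J g χ x ∘L covariantDerivAlong I J g χ ν x)

/-- The mean curvature `H = (1 / dim M) tr A`. -/
def meanCurvature (ν : ∀ x : M, TangentSpace J (χ x)) (x : M) : ℝ :=
  1 / (Module.finrank ℝ E : ℝ) *
    LinearMap.trace ℝ (TangentSpace I x) (shapeOperator I J g χ ν x).toLinearMap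

end Immersion

section WarpedProduct

variable {E : Type*} [NormedAddCommGroup E] [NormedSpace ℝ E]
  {H : Type*} [TopologicalSpace H] (J : ModelWithCorners ℝ E H)
  {Q : Type*} [TopologicalSpace Q] [ChartedSpace H Q]

/-- The warped product metric `dt² + f(t)² h` on `ℝ × Q`. -/
def warpedMetric (f : ℝ → ℝ) (h : ∀ q : Q, TangentSpace J q →L[ℝ] TangentSpace J q →L[ℝ] ℝ)
    (p : ℝ × Q) :
    TangentSpace (𝓘(ℝ, ℝ).prod J) p →L[ℝ] TangentSpace (𝓘(ℝ, ℝ).prod J) p →L[ℝ] ℝ :=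
  let B : E →L[ℝ] E →L[ℝ] ℝ := h p.2
  let π₁ : ℝ × E →L[ℝ] ℝ := ContinuousLinearMap.fst ℝ ℝ E
  let π₂ : ℝ × E →L[ℝ] E := ContinuousLinearMap.snd ℝ ℝ E
  ((ContinuousLinearMap.mul ℝ ℝ).bilinearComp π₁ π₁ + (f p.1 ^ 2) • B.bilinearComp π₂ π₂ :
    ℝ × E →L[ℝ] ℝ × E →L[ℝ] ℝ)

/-- The vector field `∂_t` on `ℝ × Q`. -/
def dt (p : ℝ × Q) : TangentSpace (𝓘(ℝ, ℝ).prod J) p := ((1, 0) : ℝ × E)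

/-- `a = ((f')² - c) / f²`. -/
def coeffA (f : ℝ → ℝ) (c t : ℝ) : ℝ := (deriv f t ^ 2 - c) / f t ^ 2

/-- `b = f'' / f - (f')² / f² + c / f²`. -/
def coeffB (f : ℝ → ℝ) (c t : ℝ) : ℝ :=
  deriv (deriv f) t / f t - deriv f t ^ 2 / f t ^ 2 + c / f t ^ 2

end WarpedProduct

end WarpedHypersurface

end

/-!
The proof rests on the Gauss equation alone. For a hypersurface of a warped product `K ×_f Q` over
an interval, with fibre of constant curvature, the trace of the Gauss equation is
`Ric = nH A - A² - ((n - 1) a + |T|² b) - (n - 2) b T ⊗ T` (`ricci_warped`). When `Ric = ρ`, this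
says that the polynomial `A² - nH A + ρ + (n - 1) a + |T|² b` in the self-adjoint endomorphism `A`
equals `-(n - 2) b T ⊗ T`. The right-hand side therefore commutes with `A`, and since `b ≠ 0`,
`T ≠ 0` and `n ≥ 3`, this forces `T` to be an eigenvector of `A`. On the orthogonal complement of
`T` the polynomial vanishes, so at most two eigenvalues occur there, while at the eigenvalue of `T`
its value `-(n - 2) b |T|²` is non-zero; hence that eigenvalue is simple
(`exists_principal_curvatures`).

The Gauss equation is obtained in the preferred charts. There the Gauss formula expresses the
covariant Hessian `D²F + Γ(DF, DF)` of the immersion `F` by its tangential part, which is the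
Levi-Civita connection of the induced metric, and the second fundamental form. Differentiating it
once more and antisymmetrizing removes the third derivatives of `F` and leaves the curvature tensors
(`IsHypersurfaceOn.exists_curvature_eq`). The curvature of the warped product is computed from its
Christoffel symbols (`curvature_warpedForm`), and the curvature tensor of the fibre is recovered from
its sectional curvatures by polarization (`curvatureLike_eq_zero`).
-/

namespace WarpedHypersurface

/-! ### Positive definite bilinear forms -/

section Algebra

variable {V : Type*} [NormedAddCommGroup V] [NormedSpace ℝ V]

theorem eq_of_forall_apply_eq {B : V →L[ℝ] V →L[ℝ] ℝ} (hB : ∀ v, v ≠ 0 → 0 < B v v)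
    {v w : V} (h : ∀ z, B v z = B w z) : v = w := by
  by_contra hne
  have h1 := hB (v - w) (sub_ne_zero.2 hne)
  rw [map_sub B, sub_apply (B v), h, sub_self] at h1
  exact h1.false

variable [FiniteDimensional ℝ V]

/-- A positive definite bilinear form on a finite-dimensional space, viewed as a map to the dual,
is invertible. -/
theorem isInvertible_of_pos {B : V →L[ℝ] V →L[ℝ] ℝ} (hB : ∀ v, v ≠ 0 → 0 < B v v) :
    B.IsInvertible := by
  have hinj : Function.Injective (B : V →ₗ[ℝ] V →L[ℝ] ℝ) := by
    rw [← LinearMap.ker_eq_bot, LinearMap.ker_eq_bot']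
    intro v hv
    by_contra hne
    have h1 := hB v hne
    have h2 : B v = 0 := hv
    simp [h2] at h1
  have hdim : Module.finrank ℝ V = Module.finrank ℝ (V →L[ℝ] ℝ) := by
    rw [← (LinearMap.toContinuousLinearMap : (V →ₗ[ℝ] ℝ) ≃ₗ[ℝ] V →L[ℝ] ℝ).finrank_eq]
    exact (Subspace.dual_finrank_eq (K := ℝ) (V := V)).symm
  exact ⟨(LinearEquiv.ofInjectiveOfFinrankEq _ hinj hdim).toContinuousLinearEquiv, by ext; rfl⟩

theorem apply_inverse_apply {B : V →L[ℝ] V →L[ℝ] ℝ} (hB : ∀ v, v ≠ 0 → 0 < B v v)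
    (l : V →L[ℝ] ℝ) : B (B.inverse l) = l :=
  (isInvertible_of_pos hB).self_apply_inverse l

end Algebra

/-! ### Derivatives of bilinear expressions -/

section Calculus

variable {E F₁ F₂ F₃ : Type*} [NormedAddCommGroup E] [NormedSpace ℝ E]
  [NormedAddCommGroup F₁] [NormedSpace ℝ F₁] [NormedAddCommGroup F₂] [NormedSpace ℝ F₂]
  [NormedAddCommGroup F₃] [NormedSpace ℝ F₃]

theorem fderiv_bilin_apply {B : E → F₁ →L[ℝ] F₂ →L[ℝ] F₃} {X : E → F₁} {Y : E → F₂} {u : E}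
    (hB : DifferentiableAt ℝ B u) (hX : DifferentiableAt ℝ X u) (hY : DifferentiableAt ℝ Y u)
    (v : E) :
    fderiv ℝ (fun p ↦ B p (X p) (Y p)) u v =
      fderiv ℝ B u v (X u) (Y u) + B u (fderiv ℝ X u v) (Y u) + B u (X u) (fderiv ℝ Y u v) := by
  rw [fderiv_clm_apply (by fun_prop) hY, fderiv_clm_apply hB hX]
  simp only [add_apply, ContinuousLinearMap.comp_apply, ContinuousLinearMap.flip_apply]
  abel

theorem fderiv_bilin_const {B : E → F₁ →L[ℝ] F₂ →L[ℝ] F₃} {u : E}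
    (hB : DifferentiableAt ℝ B u) (x : F₁) (y : F₂) (v : E) :
    fderiv ℝ (fun p ↦ B p x y) u v = fderiv ℝ B u v x y := by
  rw [fderiv_bilin_apply hB (differentiableAt_const x) (differentiableAt_const y)]
  simp

theorem fderiv_linear_const {B : E → F₁ →L[ℝ] F₂} {u : E}
    (hB : DifferentiableAt ℝ B u) (x : F₁) (v : E) :
    fderiv ℝ (fun p ↦ B p x) u v = fderiv ℝ B u v x := by
  rw [fderiv_clm_apply hB (differentiableAt_const x)]
  simp

end Calculus

/-! ### Levi-Civita connection and curvature in coordinates -/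

section Metric

variable {E : Type*} [NormedAddCommGroup E] [NormedSpace ℝ E]

theorem curvature_antisymm (G : E → E →L[ℝ] E →L[ℝ] ℝ) (u v w z : E) :
    curvature G u w z v = -curvature G u v z w := by
  simp only [curvature_apply]
  abel

/-- `G` is a smooth Riemannian metric on the open set `U`. -/
structure IsMetricOn (G : E → E →L[ℝ] E →L[ℝ] ℝ) (U : Set E) : Prop where
  isOpen : IsOpen U
  contDiffOn : ContDiffOn ℝ ∞ G U
  symm : ∀ u ∈ U, ∀ v w, G u v w = G u w v
  pos : ∀ u ∈ U, ∀ v, v ≠ 0 → 0 < G u v v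

namespace IsMetricOn

variable {G : E → E →L[ℝ] E →L[ℝ] ℝ} {U : Set E} {u : E}

theorem contDiffAt (hG : IsMetricOn G U) (hu : u ∈ U) : ContDiffAt ℝ ∞ G u :=
  hG.contDiffOn.contDiffAt (hG.isOpen.mem_nhds hu)

theorem differentiableAt (hG : IsMetricOn G U) (hu : u ∈ U) : DifferentiableAt ℝ G u :=
  (hG.contDiffAt hu).differentiableAt (by simp)

theorem differentiableAt_fderiv (hG : IsMetricOn G U) (hu : u ∈ U) :
    DifferentiableAt ℝ (fderiv ℝ G) u :=
  ((hG.contDiffAt hu).fderiv_right (m := 1) (by norm_cast)).differentiableAt (by simp)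

theorem fderiv_apply_apply (hG : IsMetricOn G U) (hu : u ∈ U) (v w x : E) :
    fderiv ℝ (fun y ↦ G y v w) u x = fderiv ℝ G u x v w :=
  fderiv_bilin_const (hG.differentiableAt hu) v w x

theorem fderiv_symm (hG : IsMetricOn G U) (hu : u ∈ U) (x v w : E) :
    fderiv ℝ G u x v w = fderiv ℝ G u x w v := by
  rw [← hG.fderiv_apply_apply hu, ← hG.fderiv_apply_apply hu]
  congr 1
  apply Filter.EventuallyEq.fderiv_eq
  filter_upwards [hG.isOpen.mem_nhds hu] with y hy using hG.symm y hy v w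

theorem christoffelFirst_symm (hG : IsMetricOn G U) (hu : u ∈ U) (v w : E) :
    christoffelFirst G u v w = christoffelFirst G u w v := by
  ext z
  rw [christoffelFirst_apply, christoffelFirst_apply, hG.fderiv_symm hu z v w]
  ring

theorem christoffel_symm (hG : IsMetricOn G U) (hu : u ∈ U) (v w : E) :
    christoffel G u v w = christoffel G u w v := by
  rw [christoffel_apply, christoffel_apply, hG.christoffelFirst_symm hu]

variable [FiniteDimensional ℝ E]

theorem apply_christoffel (hG : IsMetricOn G U) (hu : u ∈ U) (v w : E) :
    G u (christoffel G u v w) = christoffelFirst G u v w := by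
  rw [christoffel_apply, apply_inverse_apply (hG.pos u hu)]

/-- The Levi-Civita connection is compatible with the metric. -/
theorem fderiv_eq (hG : IsMetricOn G U) (hu : u ∈ U) (x v w : E) :
    fderiv ℝ G u x v w = G u (christoffel G u x v) w + G u v (christoffel G u x w) := by
  rw [hG.symm u hu v, hG.apply_christoffel hu, hG.apply_christoffel hu, christoffelFirst_apply,
    christoffelFirst_apply, hG.fderiv_symm hu x w v, hG.fderiv_symm hu v x w,
    hG.fderiv_symm hu w x v]
  ring

theorem christoffel_eq (hG : IsMetricOn G U) (hu : u ∈ U) {v w y : E}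
    (h : ∀ z, G u y z = christoffelFirst G u v w z) : christoffel G u v w = y :=
  eq_of_forall_apply_eq (hG.pos u hu) fun z ↦ by rw [hG.apply_christoffel hu, h]

set_option synthInstance.maxHeartbeats 200000 in
theorem contDiffAt_christoffel (hG : IsMetricOn G U) (hu : u ∈ U) :
    ContDiffAt ℝ ∞ (christoffel G) u := by
  have h1 : ContDiffAt ℝ ∞ (fun y ↦ (G y).inverse) u := by
    obtain ⟨e, he⟩ := isInvertible_of_pos (hG.pos u hu)
    have h2 : ContDiffAt ℝ ∞ (ContinuousLinearMap.inverse : (E →L[ℝ] E →L[ℝ] ℝ) → _) (G u) := by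
      rw [← he]; exact contDiffAt_map_inverse e
    exact h2.comp u (hG.contDiffAt hu)
  have h2 : ContDiffAt ℝ ∞ (fderiv ℝ G) u := (hG.contDiffAt hu).fderiv_right (by norm_cast)
  have h3 : ContDiffAt ℝ ∞ (christoffelFirst G) u := by
    unfold christoffelFirst
    have h4 : ContDiffAt ℝ ∞ (fun u ↦ (fderiv ℝ G u).flip) u :=
      (ContinuousLinearMap.flipₗᵢ ℝ E E (E →L[ℝ] ℝ)).contDiff.contDiffAt.comp u h2
    exact ((h2.add h4).sub (contDiffAt_const.clm_comp h4)).const_smul _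
  exact ((ContinuousLinearMap.compL ℝ E (E →L[ℝ] ℝ) E).contDiff.contDiffAt.comp u h1).clm_comp h3

theorem differentiableAt_christoffel (hG : IsMetricOn G U) (hu : u ∈ U) :
    DifferentiableAt ℝ (christoffel G) u :=
  (hG.contDiffAt_christoffel hu).differentiableAt (by simp)

theorem fderiv_christoffel_apply (hG : IsMetricOn G U) (hu : u ∈ U) (v w x : E) :
    fderiv ℝ (fun y ↦ christoffel G y v w) u x = fderiv ℝ (christoffel G) u x v w :=
  fderiv_bilin_const (hG.differentiableAt_christoffel hu) v w x

theorem fderiv_christoffel_symm (hG : IsMetricOn G U) (hu : u ∈ U) (x v w : E) :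
    fderiv ℝ (christoffel G) u x v w = fderiv ℝ (christoffel G) u x w v := by
  rw [← hG.fderiv_christoffel_apply hu, ← hG.fderiv_christoffel_apply hu]
  congr 1
  apply Filter.EventuallyEq.fderiv_eq
  filter_upwards [hG.isOpen.mem_nhds hu] with y hy using hG.christoffel_symm hy v w

theorem curvature_bianchi (hG : IsMetricOn G U) (hu : u ∈ U) (v w z : E) :
    curvature G u w z v + curvature G u z v w + curvature G u v w z = 0 := by
  simp only [curvature_apply]
  rw [hG.fderiv_christoffel_symm hu v w z, hG.fderiv_christoffel_symm hu w v z,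
    hG.fderiv_christoffel_symm hu z v w, hG.christoffel_symm hu w z, hG.christoffel_symm hu v z,
    hG.christoffel_symm hu w v]
  abel

/-- `R(v, w)` is skew-adjoint: the second derivatives of the metric are symmetric. -/
theorem curvature_skew (hG : IsMetricOn G U) (hu : u ∈ U) (v w z y : E) :
    G u (curvature G u w z v) y = -G u (curvature G u w y v) z := by
  have key : ∀ v w : E, fderiv ℝ (fderiv ℝ G) u v w z y =
      G u (christoffel G u v (christoffel G u w z)) y + G u (christoffel G u w z)
        (christoffel G u v y) + G u (fderiv ℝ (christoffel G) u v w z) y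
      + (G u (christoffel G u v z) (christoffel G u w y)
        + G u z (christoffel G u v (christoffel G u w y))
        + G u z (fderiv ℝ (christoffel G) u v w y)) := by
    intro v w
    have hd := hG.differentiableAt hu
    have hdd := hG.differentiableAt_fderiv hu
    have hc := hG.differentiableAt_christoffel hu
    have e1 : fderiv ℝ (fun p ↦ fderiv ℝ G p w z y) u v = fderiv ℝ (fderiv ℝ G) u v w z y := by
      rw [fderiv_bilin_const (by fun_prop), fderiv_linear_const hdd]
    rw [← e1]
    have e2 : (fun p ↦ fderiv ℝ G p w z y) =ᶠ[nhds u]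
        fun p ↦ G p (christoffel G p w z) y + G p z (christoffel G p w y) := by
      filter_upwards [hG.isOpen.mem_nhds hu] with p hp using hG.fderiv_eq hp w z y
    rw [e2.fderiv_eq, fderiv_fun_add (by fun_prop) (by fun_prop), add_apply,
      fderiv_bilin_apply hd (by fun_prop) (by fun_prop),
      fderiv_bilin_apply hd (by fun_prop) (by fun_prop)]
    simp only [fderiv_fun_const, Pi.zero_apply, zero_apply, map_zero, hG.fderiv_christoffel_apply hu,
      hG.fderiv_eq hu]
    ring
  have hs : fderiv ℝ (fderiv ℝ G) u v w = fderiv ℝ (fderiv ℝ G) u w v :=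
    ((hG.contDiffAt hu).isSymmSndFDerivAt (by simp; exact WithTop.coe_le_coe.2 le_top)).eq v w
  have h1 := key v w
  rw [hs, key w v] at h1
  simp only [curvature_apply, map_add, map_sub, add_apply,
    sub_apply]
  rw [hG.symm u hu _ z, hG.symm u hu _ z, hG.symm u hu _ z, hG.symm u hu _ z]
  linarith

end IsMetricOn
end Metric

/-! ### Constant sectional curvature -/

section Sectional

/-- A curvature-like tensor is determined by its sectional curvatures. -/
theorem curvatureLike_eq_zero {V : Type*} [AddCommGroup V] {S : V → V → V → V → ℝ}
    (h1 : ∀ v v' w z y, S (v + v') w z y = S v w z y + S v' w z y)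
    (h12 : ∀ v w z y, S v w z y = -S w v z y) (h34 : ∀ v w z y, S v w z y = -S v w y z)
    (hb : ∀ v w z y, S v w z y + S w z v y + S z v w y = 0) (h0 : ∀ v w, S v w w v = 0)
    (v w z y : V) : S v w z y = 0 := by
  have hpair : ∀ v w z y, S v w z y = S z y v w := fun v w z y ↦ by
    have b1 := hb v w z y
    have b2 := hb w z y v
    have b3 := hb z y v w
    have b4 := hb y v w z
    linarith [h34 w z v y, h34 z v w y, h12 z v w y, h34 z v y w, h34 z y w v, h34 y w z v,
      h12 y w z v, h34 y w v z, h12 v z y w, h34 v z y w, h34 y v z w, h12 y v z w, h34 v w y z,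
      h34 w y v z, h12 w y v z, h34 v y z w, h12 v y z w, h34 w z y v]
  have h2 : ∀ v w w' z y, S v (w + w') z y = S v w z y + S v w' z y := fun v w w' z y ↦ by
    rw [h12, h1, h12 w, h12 w']; ring
  have h3 : ∀ v w z z' y, S v w (z + z') y = S v w z y + S v w z' y := fun v w z z' y ↦ by
    rw [hpair v w, h1, ← hpair v w z, ← hpair v w z']
  have h4 : ∀ v w z y y', S v w z (y + y') = S v w z y + S v w z y' := fun v w z y y' ↦ by
    linarith [h34 v w z (y + y'), h3 v w y y' z, h34 v w y z, h34 v w y' z]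
  have hs : ∀ v w y, S v w w y = 0 := fun v w y ↦ by
    have e := h0 (v + y) w
    rw [h1, h4, h4, h0, h0] at e
    linarith [hpair y w w v, h12 w v y w, h34 v w y w]
  have h23 : ∀ v w z y, S v w z y = -S v z w y := fun v w z y ↦ by
    have e := hs v (w + z) y
    rw [h2, h3, h3, hs, hs] at e
    linarith
  linarith [hb v w z y, h23 w z v y, h12 w v z y, h12 z v w y, h23 v z w y]

variable {E : Type*} [NormedAddCommGroup E] [NormedSpace ℝ E] [FiniteDimensional ℝ E]
variable {G : E → E →L[ℝ] E →L[ℝ] ℝ} {U : Set E} {u : E}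

theorem IsMetricOn.curvature_eq_of_sectional (hG : IsMetricOn G U) (hu : u ∈ U) {c : ℝ}
    (hc : ∀ v w, G u (curvature G u w w v) v = c * (G u v v * G u w w - G u v w ^ 2))
    (v w z : E) : curvature G u w z v = c • (G u w z • v - G u v z • w) := by
  refine eq_of_forall_apply_eq (hG.pos u hu) fun y ↦ ?_
  have key := curvatureLike_eq_zero (S := fun v w z y ↦ G u (curvature G u w z v) y
    - c * (G u w z * G u v y - G u v z * G u w y)) ?_ ?_ ?_ ?_ ?_ v w z y
  · simp only [map_smul, map_sub, smul_apply, sub_apply, smul_eq_mul]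
    linarith
  · intro v v' w z y
    simp only [map_add, add_apply]
    ring
  · intro v w z y
    rw [curvature_antisymm, map_neg, neg_apply]
    ring
  · intro v w z y
    rw [hG.curvature_skew hu]
    ring
  · intro v w z y
    have e := congrArg (fun p ↦ G u p y) (hG.curvature_bianchi hu v w z)
    simp only [map_add, add_apply, map_zero, zero_apply] at e
    rw [hG.symm u hu z v, hG.symm u hu w v, hG.symm u hu z w]
    linarith
  · intro v w
    rw [hc, hG.symm u hu w v]
    ring

end Sectional

/-! ### Warped products in coordinates -/

section Warped

variable {E : Type*} [NormedAddCommGroup E] [NormedSpace ℝ E]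

/-- The warped product `dt² + f(t)² h` in coordinates. -/
noncomputable def warpedForm (f : ℝ → ℝ) (h : E → E →L[ℝ] E →L[ℝ] ℝ) (p : ℝ × E) :
    ℝ × E →L[ℝ] ℝ × E →L[ℝ] ℝ :=
  (ContinuousLinearMap.mul ℝ ℝ).bilinearComp (ContinuousLinearMap.fst ℝ ℝ E)
    (ContinuousLinearMap.fst ℝ ℝ E) + (f p.1 ^ 2) • (h p.2).bilinearComp
      (ContinuousLinearMap.snd ℝ ℝ E) (ContinuousLinearMap.snd ℝ ℝ E)

theorem warpedForm_apply (f : ℝ → ℝ) (h : E → E →L[ℝ] E →L[ℝ] ℝ) (p X Y : ℝ × E) :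
    warpedForm f h p X Y = X.1 * Y.1 + f p.1 ^ 2 * h p.2 X.2 Y.2 :=
  rfl

theorem fderiv_comp_fst {F : Type*} [NormedAddCommGroup F] [NormedSpace ℝ F] {g : ℝ → F}
    {p : ℝ × E} (hg : DifferentiableAt ℝ g p.1) (X : ℝ × E) :
    fderiv ℝ (fun q : ℝ × E ↦ g q.1) p X = X.1 • deriv g p.1 := by
  have := (hg.hasFDerivAt.comp p hasFDerivAt_fst).fderiv
  rw [Function.comp_def] at this
  rw [this]
  simp

theorem fderiv_comp_snd {F : Type*} [NormedAddCommGroup F] [NormedSpace ℝ F] {g : E → F}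
    {p : ℝ × E} (hg : DifferentiableAt ℝ g p.2) (X : ℝ × E) :
    fderiv ℝ (fun q : ℝ × E ↦ g q.2) p X = fderiv ℝ g p.2 X.2 := by
  have := (hg.hasFDerivAt.comp p hasFDerivAt_snd).fderiv
  rw [Function.comp_def] at this
  rw [this]
  simp

variable {f : ℝ → ℝ} {h : E → E →L[ℝ] E →L[ℝ] ℝ} {K : Set ℝ} {U : Set E}

theorem contDiffAt_of_isOpen (hK : IsOpen K) (hf : ContDiffOn ℝ ∞ f K) {t : ℝ} (ht : t ∈ K) :
    ContDiffAt ℝ ∞ f t :=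
  hf.contDiffAt (hK.mem_nhds ht)

variable [FiniteDimensional ℝ E]

theorem isMetricOn_warpedForm (hK : IsOpen K) (hf : ContDiffOn ℝ ∞ f K)
    (hfpos : ∀ t ∈ K, 0 < f t) (hh : IsMetricOn h U) :
    IsMetricOn (warpedForm f h) (K ×ˢ U) where
  isOpen := hK.prod hh.isOpen
  contDiffOn := by
    have h1 : ContDiffOn ℝ ∞ (fun p : ℝ × E ↦ f p.1 ^ 2) (K ×ˢ U) :=
      (hf.comp contDiffOn_fst fun p hp ↦ hp.1).pow 2
    have h2 : ContDiffOn ℝ ∞ (fun p : ℝ × E ↦ h p.2) (K ×ˢ U) :=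
      hh.contDiffOn.comp contDiffOn_snd fun p hp ↦ hp.2
    rw [contDiffOn_clm_apply]
    intro X
    rw [contDiffOn_clm_apply]
    intro Y
    simp only [warpedForm_apply]
    exact contDiffOn_const.add
      (h1.mul ((h2.clm_apply contDiffOn_const).clm_apply contDiffOn_const))
  symm p hp X Y := by
    rw [warpedForm_apply, warpedForm_apply, hh.symm _ hp.2, mul_comm X.1]
  pos p hp X hX := by
    rw [warpedForm_apply]
    have hf0 := hfpos _ hp.1
    by_cases h2 : X.2 = 0
    · have h1 : X.1 ≠ 0 := fun h1 ↦ hX (Prod.ext h1 h2)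
      rw [h2, map_zero, mul_zero, add_zero]
      exact mul_self_pos.2 h1
    · have := hh.pos _ hp.2 _ h2
      nlinarith [mul_self_nonneg X.1, mul_pos (pow_pos hf0 2) this]

theorem fderiv_warpedForm (hK : IsOpen K) (hf : ContDiffOn ℝ ∞ f K)
    (hfpos : ∀ t ∈ K, 0 < f t) (hh : IsMetricOn h U) {p : ℝ × E} (hp : p ∈ K ×ˢ U)
    (X Y Z : ℝ × E) :
    fderiv ℝ (warpedForm f h) p X Y Z = 2 * f p.1 * deriv f p.1 * X.1 * h p.2 Y.2 Z.2
      + f p.1 ^ 2 * fderiv ℝ h p.2 X.2 Y.2 Z.2 := by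
  have hfd : DifferentiableAt ℝ f p.1 :=
    (contDiffAt_of_isOpen hK hf hp.1).differentiableAt (by simp)
  have hhd := hh.differentiableAt hp.2
  rw [← (isMetricOn_warpedForm hK hf hfpos hh).fderiv_apply_apply hp]
  simp only [warpedForm_apply]
  rw [fderiv_const_add, fderiv_fun_mul (by fun_prop) (by fun_prop), add_apply, smul_apply,
    smul_apply, fderiv_comp_fst (g := fun t ↦ f t ^ 2) (by fun_prop),
    fderiv_comp_snd (g := fun q ↦ h q Y.2 Z.2) (by fun_prop), hh.fderiv_apply_apply hp.2,
    deriv_fun_pow hfd]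
  simp only [smul_eq_mul]
  push_cast
  ring

theorem christoffel_warpedForm (hK : IsOpen K) (hf : ContDiffOn ℝ ∞ f K)
    (hfpos : ∀ t ∈ K, 0 < f t) (hh : IsMetricOn h U) {p : ℝ × E} (hp : p ∈ K ×ˢ U)
    (X Y : ℝ × E) :
    christoffel (warpedForm f h) p X Y = (-(f p.1 * deriv f p.1 * h p.2 X.2 Y.2),
      (deriv f p.1 / f p.1) • (X.1 • Y.2 + Y.1 • X.2) + christoffel h p.2 X.2 Y.2) := by
  refine (isMetricOn_warpedForm hK hf hfpos hh).christoffel_eq hp fun Z ↦ ?_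
  have hf0 := (hfpos _ hp.1).ne'
  rw [christoffelFirst_apply, warpedForm_apply, fderiv_warpedForm hK hf hfpos hh hp,
    fderiv_warpedForm hK hf hfpos hh hp, fderiv_warpedForm hK hf hfpos hh hp]
  simp only [map_add, map_smul, add_apply, smul_apply, smul_eq_mul, hh.apply_christoffel hp.2,
    christoffelFirst_apply]
  field_simp
  ring

/-- The curvature tensor of a warped product over an interval. -/
theorem curvature_warpedForm (hK : IsOpen K) (hf : ContDiffOn ℝ ∞ f K)
    (hfpos : ∀ t ∈ K, 0 < f t) (hh : IsMetricOn h U) {p : ℝ × E} (hp : p ∈ K ×ˢ U)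
    (X Y Z : ℝ × E) :
    curvature (warpedForm f h) p Y Z X =
      (-(f p.1 * deriv (deriv f) p.1 * (X.1 * h p.2 Y.2 Z.2 - Y.1 * h p.2 X.2 Z.2)),
        (deriv (deriv f) p.1 / f p.1 * Z.1) • (X.1 • Y.2 - Y.1 • X.2)
        + curvature h p.2 Y.2 Z.2 X.2
        - (deriv f p.1 ^ 2) • (h p.2 Y.2 Z.2 • X.2 - h p.2 X.2 Z.2 • Y.2)) := by
  have hf0 := (hfpos _ hp.1).ne'
  have hfc := contDiffAt_of_isOpen hK hf hp.1
  have hfd : DifferentiableAt ℝ f p.1 := hfc.differentiableAt (by simp)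
  have hfdd : DifferentiableAt ℝ (deriv f) p.1 := by
    have h1 : ContDiffAt ℝ 1 (fderiv ℝ f) p.1 := hfc.fderiv_right (by norm_cast)
    have h2 := h1.differentiableAt (by simp)
    exact h2.clm_apply (differentiableAt_const 1)
  have hhd := hh.differentiableAt hp.2
  have hcd := hh.differentiableAt_christoffel hp.2
  have hG := isMetricOn_warpedForm hK hf hfpos hh
  have hD : ∀ X Y Z : ℝ × E, fderiv ℝ (christoffel (warpedForm f h)) p X Y Z =
      (-(X.1 * (deriv f p.1 ^ 2 + f p.1 * deriv (deriv f) p.1) * h p.2 Y.2 Z.2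
          + f p.1 * deriv f p.1 * fderiv ℝ h p.2 X.2 Y.2 Z.2),
        (X.1 * ((deriv (deriv f) p.1 * f p.1 - deriv f p.1 ^ 2) / f p.1 ^ 2)) •
          (Y.1 • Z.2 + Z.1 • Y.2) + fderiv ℝ (christoffel h) p.2 X.2 Y.2 Z.2) := by
    intro X Y Z
    rw [← hG.fderiv_christoffel_apply hp]
    have e : (fun q ↦ christoffel (warpedForm f h) q Y Z) =ᶠ[nhds p]
        fun q ↦ (-(f q.1 * deriv f q.1 * h q.2 Y.2 Z.2),
      (deriv f q.1 / f q.1) • (Y.1 • Z.2 + Z.1 • Y.2) + christoffel h q.2 Y.2 Z.2) := by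
      filter_upwards [hG.isOpen.mem_nhds hp] with q hq
      exact christoffel_warpedForm hK hf hfpos hh hq Y Z
    rw [e.fderiv_eq, DifferentiableAt.fderiv_prodMk (by fun_prop) (by fun_prop (disch := exact hf0)),
      ContinuousLinearMap.prod_apply]
    congr 1
    · rw [fderiv_fun_neg, neg_apply, fderiv_fun_mul (by fun_prop) (by fun_prop), add_apply,
        smul_apply, smul_apply, fderiv_comp_fst (g := fun t ↦ f t * deriv f t) (by fun_prop),
        fderiv_comp_snd (g := fun q ↦ h q Y.2 Z.2) (by fun_prop), hh.fderiv_apply_apply hp.2,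
        deriv_fun_mul hfd hfdd]
      simp only [smul_eq_mul]
      ring
    · rw [fderiv_fun_add (by fun_prop (disch := exact hf0)) (by fun_prop), add_apply,
        fderiv_comp_snd (g := fun q ↦ christoffel h q Y.2 Z.2) (by fun_prop),
        fderiv_comp_fst (g := fun t ↦ (deriv f t / f t) • (Y.1 • Z.2 + Z.1 • Y.2))
          (by fun_prop (disch := exact hf0)), hh.fderiv_christoffel_apply hp.2,
        deriv_smul_const (by fun_prop (disch := exact hf0)), deriv_fun_div hfdd hfd hf0, smul_smul,
        pow_two (deriv f p.1)]
  rw [curvature_apply, hD, hD]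
  simp only [christoffel_warpedForm hK hf hfpos hh hp]
  apply Prod.ext
  · simp only [Prod.fst_add, Prod.fst_sub, hh.fderiv_eq hp.2, map_add, map_smul, smul_eq_mul]
    rw [hh.christoffel_symm hp.2 Y.2 X.2, hh.symm _ hp.2 Y.2 X.2]
    field_simp
    ring
  · simp only [Prod.snd_add, Prod.snd_sub, map_add, map_smul, curvature_apply]
    rw [hh.christoffel_symm hp.2 Y.2 X.2]
    match_scalars <;> field_simp <;> ring

/-- Over a fibre of constant curvature `c`, the curvature tensor of a warped product is expressed
by the metric, the vector `∂_t` and the coefficients `a` and `b`. -/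
theorem curvature_warpedForm_of_const (hK : IsOpen K) (hf : ContDiffOn ℝ ∞ f K)
    (hfpos : ∀ t ∈ K, 0 < f t) (hh : IsMetricOn h U) {p : ℝ × E} (hp : p ∈ K ×ˢ U) {c : ℝ}
    (hc : ∀ v w, h p.2 (curvature h p.2 w w v) v
      = c * (h p.2 v v * h p.2 w w - h p.2 v w ^ 2)) (X Y Z : ℝ × E) :
    curvature (warpedForm f h) p Y Z X =
      -(coeffA f c p.1 • (warpedForm f h p Y Z • X - warpedForm f h p X Z • Y))
      - coeffB f c p.1 • ((Y.1 * Z.1) • X - (X.1 * Z.1) • Y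
        + (warpedForm f h p Y Z * X.1 - warpedForm f h p X Z * Y.1) • ((1, 0) : ℝ × E)) := by
  have hf0 := (hfpos _ hp.1).ne'
  rw [curvature_warpedForm hK hf hfpos hh hp, hh.curvature_eq_of_sectional hp.2 hc]
  simp only [warpedForm_apply, coeffA, coeffB]
  apply Prod.ext
  · simp only [Prod.fst_add, Prod.fst_sub, Prod.smul_fst, Prod.fst_neg, smul_eq_mul]
    field_simp
    ring
  · simp only [Prod.snd_add, Prod.snd_sub, Prod.smul_snd, Prod.snd_neg]
    match_scalars <;> field_simp <;> ring

end Warped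

/-! ### The Gauss equation in coordinates -/

section Gauss

variable {E E' : Type*} [NormedAddCommGroup E] [NormedSpace ℝ E]
  [NormedAddCommGroup E'] [NormedSpace ℝ E']

/-- `F : U → U'` is an immersed hypersurface of the Riemannian domain `(U', G')`, with induced
metric `G` and unit normal field `V`. -/
structure IsHypersurfaceOn (G : E → E →L[ℝ] E →L[ℝ] ℝ) (G' : E' → E' →L[ℝ] E' →L[ℝ] ℝ)
    (F V : E → E') (U : Set E) (U' : Set E') : Prop where
  ambient : IsMetricOn G' U'
  isOpen : IsOpen U
  mapsTo : Set.MapsTo F U U'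
  contDiffOn : ContDiffOn ℝ ∞ F U
  contDiffOn_normal : ContDiffOn ℝ ∞ V U
  injective : ∀ u ∈ U, Function.Injective (fderiv ℝ F u)
  induced : ∀ u ∈ U, ∀ v w, G u v w = G' (F u) (fderiv ℝ F u v) (fderiv ℝ F u w)
  unit : ∀ u ∈ U, G' (F u) (V u) (V u) = 1
  normal : ∀ u ∈ U, ∀ v, G' (F u) (V u) (fderiv ℝ F u v) = 0
  finrank_eq : Module.finrank ℝ E' = Module.finrank ℝ E + 1

/-- The Hessian `D²F(v, w) + Γ(DF v, DF w)` of a map `F` into the Riemannian domain `G'`. -/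
noncomputable def covHessian (G' : E' → E' →L[ℝ] E' →L[ℝ] ℝ) (F : E → E') (u v w : E) : E' :=
  fderiv ℝ (fderiv ℝ F) u v w + christoffel G' (F u) (fderiv ℝ F u v) (fderiv ℝ F u w)

/-- The covariant derivative `D_v V + Γ(DF v, V)` of a vector field `V` along `F`. -/
noncomputable def covDeriv (G' : E' → E' →L[ℝ] E' →L[ℝ] ℝ) (F V : E → E') (u v : E) : E' :=
  fderiv ℝ V u v + christoffel G' (F u) (fderiv ℝ F u v) (V u)

/-- The second fundamental form with respect to the normal field `V`. -/
noncomputable def secondForm (G' : E' → E' →L[ℝ] E' →L[ℝ] ℝ) (F V : E → E') (u v w : E) : ℝ :=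
  G' (F u) (covHessian G' F u v w) (V u)

namespace IsHypersurfaceOn

variable {G : E → E →L[ℝ] E →L[ℝ] ℝ} {G' : E' → E' →L[ℝ] E' →L[ℝ] ℝ} {F V : E → E'}
  {U : Set E} {U' : Set E'} {u : E}

theorem contDiffAt (hF : IsHypersurfaceOn G G' F V U U') (hu : u ∈ U) : ContDiffAt ℝ ∞ F u :=
  hF.contDiffOn.contDiffAt (hF.isOpen.mem_nhds hu)

theorem differentiableAt (hF : IsHypersurfaceOn G G' F V U U') (hu : u ∈ U) :
    DifferentiableAt ℝ F u :=
  (hF.contDiffAt hu).differentiableAt (by simp)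

theorem contDiffAt_fderiv (hF : IsHypersurfaceOn G G' F V U U') (hu : u ∈ U) :
    ContDiffAt ℝ ∞ (fderiv ℝ F) u :=
  (hF.contDiffAt hu).fderiv_right (by norm_cast)

theorem differentiableAt_fderiv (hF : IsHypersurfaceOn G G' F V U U') (hu : u ∈ U) :
    DifferentiableAt ℝ (fderiv ℝ F) u :=
  (hF.contDiffAt_fderiv hu).differentiableAt (by simp)

theorem differentiableAt_fderiv_fderiv (hF : IsHypersurfaceOn G G' F V U U') (hu : u ∈ U) :
    DifferentiableAt ℝ (fderiv ℝ (fderiv ℝ F)) u :=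
  ((hF.contDiffAt_fderiv hu).fderiv_right (m := 1) (by norm_cast)).differentiableAt (by simp)

theorem differentiableAt_normal (hF : IsHypersurfaceOn G G' F V U U') (hu : u ∈ U) :
    DifferentiableAt ℝ V u :=
  (hF.contDiffOn_normal.contDiffAt (hF.isOpen.mem_nhds hu)).differentiableAt (by simp)

theorem isMetricOn (hF : IsHypersurfaceOn G G' F V U U') [FiniteDimensional ℝ E] :
    IsMetricOn G U where
  isOpen := hF.isOpen
  contDiffOn := by
    rw [contDiffOn_clm_apply]
    intro v
    rw [contDiffOn_clm_apply]
    intro w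
    refine ContDiffOn.congr ?_ fun u hu ↦ hF.induced u hu v w
    have h1 : ContDiffOn ℝ ∞ (fderiv ℝ F) U :=
      fun u hu ↦ (hF.contDiffAt_fderiv hu).contDiffWithinAt
    have h2 : ContDiffOn ℝ ∞ (fun u ↦ G' (F u)) U :=
      hF.ambient.contDiffOn.comp hF.contDiffOn hF.mapsTo
    exact (h2.clm_apply (h1.clm_apply contDiffOn_const)).clm_apply (h1.clm_apply contDiffOn_const)
  symm u hu v w := by
    rw [hF.induced u hu, hF.induced u hu, hF.ambient.symm _ (hF.mapsTo hu)]
  pos u hu v hv := by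
    rw [hF.induced u hu]
    refine hF.ambient.pos _ (hF.mapsTo hu) _ fun h ↦ hv (hF.injective u hu ?_)
    rw [h, map_zero]

theorem covHessian_symm (hF : IsHypersurfaceOn G G' F V U U') (hu : u ∈ U) (v w : E) :
    covHessian G' F u v w = covHessian G' F u w v := by
  have hs : fderiv ℝ (fderiv ℝ F) u v w = fderiv ℝ (fderiv ℝ F) u w v :=
    ((hF.contDiffAt hu).isSymmSndFDerivAt (by simp; exact WithTop.coe_le_coe.2 le_top)).eq v w
  rw [covHessian, covHessian, hs, hF.ambient.christoffel_symm (hF.mapsTo hu)]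

theorem secondForm_symm (hF : IsHypersurfaceOn G G' F V U U') (hu : u ∈ U) (v w : E) :
    secondForm G' F V u v w = secondForm G' F V u w v := by
  rw [secondForm, secondForm, hF.covHessian_symm hu]

theorem fderiv_ambient_comp (hF : IsHypersurfaceOn G G' F V U U') (hu : u ∈ U) (v : E) :
    fderiv ℝ (fun p ↦ G' (F p)) u v = fderiv ℝ G' (F u) (fderiv ℝ F u v) := by
  have := fderiv_comp u (hF.ambient.differentiableAt (hF.mapsTo hu)) (hF.differentiableAt hu)
  rw [Function.comp_def] at this
  rw [this]
  rfl

theorem differentiableAt_ambient_comp (hF : IsHypersurfaceOn G G' F V U U') (hu : u ∈ U) :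
    DifferentiableAt ℝ (fun p ↦ G' (F p)) u :=
  (hF.ambient.differentiableAt (hF.mapsTo hu)).comp u (hF.differentiableAt hu)

/-- The third derivatives of `F` are symmetric in the first two arguments. -/
theorem fderiv_fderiv_fderiv_symm (hF : IsHypersurfaceOn G G' F V U U') (hu : u ∈ U)
    (x v w : E) : fderiv ℝ (fderiv ℝ (fderiv ℝ F)) u x v w
      = fderiv ℝ (fderiv ℝ (fderiv ℝ F)) u v x w := by
  rw [((hF.contDiffAt_fderiv hu).isSymmSndFDerivAt
    (by simp; exact WithTop.coe_le_coe.2 le_top)).eq x v]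

variable [FiniteDimensional ℝ E']

theorem differentiableAt_christoffel_comp (hF : IsHypersurfaceOn G G' F V U U') (hu : u ∈ U) :
    DifferentiableAt ℝ (fun p ↦ christoffel G' (F p)) u :=
  (hF.ambient.differentiableAt_christoffel (hF.mapsTo hu)).comp u (hF.differentiableAt hu)

theorem fderiv_christoffel_comp (hF : IsHypersurfaceOn G G' F V U U') (hu : u ∈ U) (v : E) :
    fderiv ℝ (fun p ↦ christoffel G' (F p)) u v
      = fderiv ℝ (christoffel G') (F u) (fderiv ℝ F u v) := by
  have := fderiv_comp u (hF.ambient.differentiableAt_christoffel (hF.mapsTo hu))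
    (hF.differentiableAt hu)
  rw [Function.comp_def] at this
  rw [this]
  rfl

theorem differentiableAt_covHessian (hF : IsHypersurfaceOn G G' F V U U') (hu : u ∈ U) (v w : E) :
    DifferentiableAt ℝ (fun p ↦ covHessian G' F p v w) u := by
  have h1 := hF.differentiableAt_fderiv hu
  have h2 := hF.differentiableAt_fderiv_fderiv hu
  have h3 := hF.differentiableAt_christoffel_comp hu
  unfold covHessian
  fun_prop

theorem differentiableAt_secondForm (hF : IsHypersurfaceOn G G' F V U U') (hu : u ∈ U) (v w : E) :
    DifferentiableAt ℝ (fun p ↦ secondForm G' F V p v w) u := by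
  have h1 := hF.differentiableAt_covHessian hu v w
  have h2 := hF.differentiableAt_ambient_comp hu
  have h3 := hF.differentiableAt_normal hu
  exact (h2.clm_apply h1).clm_apply h3

/-- In codimension one, a vector of the ambient space is determined by its pairings with the
tangent space and with the normal vector. -/
theorem eq_of_apply_eq (hF : IsHypersurfaceOn G G' F V U U') [FiniteDimensional ℝ E]
    (hu : u ∈ U) {y y' : E'}
    (ht : ∀ v, G' (F u) y (fderiv ℝ F u v) = G' (F u) y' (fderiv ℝ F u v))
    (hn : G' (F u) y (V u) = G' (F u) y' (V u)) : y = y' := by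
  let L : E × ℝ →ₗ[ℝ] E' := ((fderiv ℝ F u).coprod
    ((ContinuousLinearMap.id ℝ ℝ).smulRight (V u))).toLinearMap
  have hL : ∀ p, L p = fderiv ℝ F u p.1 + p.2 • V u := fun p ↦ rfl
  have hinj : Function.Injective L := by
    rw [← LinearMap.ker_eq_bot, LinearMap.ker_eq_bot']
    rintro ⟨v, s⟩ h
    rw [hL] at h
    have hs : s = 0 := by
      have := congrArg (G' (F u) (V u)) h
      simpa [hF.normal u hu, hF.unit u hu] using this
    subst hs
    have hv : fderiv ℝ F u v = fderiv ℝ F u 0 := by simpa using h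
    rw [hF.injective u hu hv]
    rfl
  have hsurj : Function.Surjective L :=
    (LinearMap.injective_iff_surjective_of_finrank_eq_finrank
      (by rw [hF.finrank_eq, Module.finrank_prod, Module.finrank_self])).1 hinj
  refine eq_of_forall_apply_eq (hF.ambient.pos _ (hF.mapsTo hu)) fun z ↦ ?_
  obtain ⟨⟨v, s⟩, rfl⟩ := hsurj z
  rw [hL, map_add, map_add, map_smul, map_smul, ht, hn]

/-- The Weingarten relation: the derivative of `⟨V, DF w⟩ = 0`. -/
theorem apply_covDeriv (hF : IsHypersurfaceOn G G' F V U U') (hu : u ∈ U) (v w : E) :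
    G' (F u) (covDeriv G' F V u v) (fderiv ℝ F u w) = -secondForm G' F V u v w := by
  have h1 := hF.differentiableAt_fderiv hu
  have e : (fun p ↦ G' (F p) (V p) (fderiv ℝ F p w)) =ᶠ[nhds u] fun _ ↦ 0 := by
    filter_upwards [hF.isOpen.mem_nhds hu] with p hp using hF.normal p hp w
  have h2 := DFunLike.congr_fun (e.fderiv_eq (𝕜 := ℝ)) v
  simp only [fderiv_fun_const, Pi.zero_apply, zero_apply] at h2
  rw [fderiv_bilin_apply (hF.differentiableAt_ambient_comp hu) (hF.differentiableAt_normal hu)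
    (by fun_prop), hF.fderiv_ambient_comp hu, fderiv_linear_const h1,
    hF.ambient.fderiv_eq (hF.mapsTo hu)] at h2
  rw [secondForm, covDeriv, covHessian, hF.ambient.symm _ (hF.mapsTo hu) _ (V u)]
  simp only [map_add, add_apply]
  linarith

variable [FiniteDimensional ℝ E]

/-- The derivative of the induced metric, by compatibility of the ambient connection. -/
theorem fderiv_induced (hF : IsHypersurfaceOn G G' F V U U') (hu : u ∈ U) (x v w : E) :
    fderiv ℝ G u x v w = G' (F u) (covHessian G' F u x v) (fderiv ℝ F u w)
      + G' (F u) (fderiv ℝ F u v) (covHessian G' F u x w) := by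
  have h1 := hF.differentiableAt_fderiv hu
  rw [← hF.isMetricOn.fderiv_apply_apply hu]
  have e : (fun p ↦ G p v w) =ᶠ[nhds u]
      fun p ↦ G' (F p) (fderiv ℝ F p v) (fderiv ℝ F p w) := by
    filter_upwards [hF.isOpen.mem_nhds hu] with p hp using hF.induced p hp v w
  rw [e.fderiv_eq, fderiv_bilin_apply (hF.differentiableAt_ambient_comp hu) (by fun_prop)
    (by fun_prop), hF.fderiv_ambient_comp hu, fderiv_linear_const h1, fderiv_linear_const h1,
    hF.ambient.fderiv_eq (hF.mapsTo hu), covHessian, covHessian]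
  simp only [map_add, add_apply]
  ring

/-- The tangential part of the Hessian of `F` is the Levi-Civita connection of the induced
metric. -/
theorem apply_covHessian (hF : IsHypersurfaceOn G G' F V U U') (hu : u ∈ U) (v w z : E) :
    G' (F u) (covHessian G' F u v w) (fderiv ℝ F u z) = G u (christoffel G u v w) z := by
  have hs := hF.ambient.symm _ (hF.mapsTo hu)
  rw [hF.isMetricOn.apply_christoffel hu, christoffelFirst_apply, hF.fderiv_induced hu,
    hF.fderiv_induced hu, hF.fderiv_induced hu, hF.covHessian_symm hu w v,
    hF.covHessian_symm hu z v, hF.covHessian_symm hu z w,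
    hs (fderiv ℝ F u w), hs (fderiv ℝ F u v)]
  ring

/-- The Gauss formula. -/
theorem covHessian_eq (hF : IsHypersurfaceOn G G' F V U U') (hu : u ∈ U) (v w : E) :
    covHessian G' F u v w =
      fderiv ℝ F u (christoffel G u v w) + secondForm G' F V u v w • V u := by
  refine hF.eq_of_apply_eq hu (fun z ↦ ?_) ?_
  · rw [hF.apply_covHessian hu, hF.induced u hu]
    simp [hF.normal u hu]
  · rw [map_add, map_smul, add_apply, smul_apply, hF.unit u hu,
      hF.ambient.symm _ (hF.mapsTo hu) (fderiv ℝ F u _) (V u), hF.normal u hu, secondForm]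
    simp

/-- The Gauss and Codazzi equations in one vector identity. The normal component `s`, which carries
the Codazzi equation, is left unspecified. -/
theorem exists_curvature_eq (hF : IsHypersurfaceOn G G' F V U U') (hu : u ∈ U) (x v w : E) :
    ∃ s : ℝ, fderiv ℝ F u (curvature G u v w x) + s • V u
      + secondForm G' F V u v w • covDeriv G' F V u x
      - secondForm G' F V u x w • covDeriv G' F V u v
      = curvature G' (F u) (fderiv ℝ F u v) (fderiv ℝ F u w) (fderiv ℝ F u x) := by
  have h1 := hF.differentiableAt_fderiv hu
  have h2 := hF.differentiableAt_fderiv_fderiv hu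
  have h3 := hF.differentiableAt_christoffel_comp hu
  have h4 := hF.isMetricOn.differentiableAt_christoffel hu
  have h5 := hF.differentiableAt_normal hu
  -- differentiate the Gauss formula for `(v, w)` in the direction `x`
  have key : ∀ x v : E,
      fderiv ℝ (fderiv ℝ (fderiv ℝ F)) u x v w
        + (fderiv ℝ (christoffel G') (F u) (fderiv ℝ F u x) (fderiv ℝ F u v) (fderiv ℝ F u w)
          + christoffel G' (F u) (fderiv ℝ (fderiv ℝ F) u x v) (fderiv ℝ F u w)
          + christoffel G' (F u) (fderiv ℝ F u v) (fderiv ℝ (fderiv ℝ F) u x w))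
      = fderiv ℝ (fderiv ℝ F) u x (christoffel G u v w)
        + fderiv ℝ F u (fderiv ℝ (christoffel G) u x v w)
        + (secondForm G' F V u v w • fderiv ℝ V u x
          + fderiv ℝ (fun p ↦ secondForm G' F V p v w) u x • V u) := by
    intro x v
    have h6 := hF.differentiableAt_secondForm hu v w
    have e : (fun p ↦ covHessian G' F p v w) =ᶠ[nhds u] fun p ↦
        fderiv ℝ F p (christoffel G p v w) + secondForm G' F V p v w • V p := by
      filter_upwards [hF.isOpen.mem_nhds hu] with p hp using hF.covHessian_eq hp v w
    have h7 := DFunLike.congr_fun (e.fderiv_eq (𝕜 := ℝ)) x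
    simp only [covHessian] at h7
    rw [fderiv_fun_add (by fun_prop) (by fun_prop), add_apply, fderiv_bilin_const h2,
      fderiv_bilin_apply h3 (by fun_prop) (by fun_prop), fderiv_linear_const h1,
      fderiv_linear_const h1, hF.fderiv_christoffel_comp hu,
      fderiv_fun_add (by fun_prop) (by fun_prop), add_apply, fderiv_clm_apply h1 (by fun_prop),
      fderiv_fun_smul h6 h5, add_apply, add_apply, ContinuousLinearMap.comp_apply,
      hF.isMetricOn.fderiv_christoffel_apply hu] at h7
    rw [h7]
    simp only [ContinuousLinearMap.flip_apply, smul_apply, ContinuousLinearMap.smulRight_apply]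
    abel
  refine ⟨secondForm G' F V u x (christoffel G u v w) - secondForm G' F V u v (christoffel G u x w)
    + fderiv ℝ (fun p ↦ secondForm G' F V p v w) u x
    - fderiv ℝ (fun p ↦ secondForm G' F V p x w) u v, ?_⟩
  have hH : ∀ v w, fderiv ℝ (fderiv ℝ F) u v w = fderiv ℝ F u (christoffel G u v w)
      + secondForm G' F V u v w • V u
      - christoffel G' (F u) (fderiv ℝ F u v) (fderiv ℝ F u w) := fun v w ↦ by
    rw [← hF.covHessian_eq hu, covHessian, add_sub_cancel_right]
  have k1 := key x v
  have k2 := key v x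
  rw [hF.fderiv_fderiv_fderiv_symm hu v x w] at k2
  have hcs : fderiv ℝ (fderiv ℝ F) u x v = fderiv ℝ (fderiv ℝ F) u v x :=
    ((hF.contDiffAt hu).isSymmSndFDerivAt (by simp; exact WithTop.coe_le_coe.2 le_top)).eq x v
  -- all second derivatives are now replaced by means of the Gauss formula
  rw [hcs, hH x w, hH x (christoffel G u v w)] at k1
  rw [hH v w, hH v (christoffel G u x w)] at k2
  simp only [curvature_apply, map_add, map_sub, map_smul, covDeriv] at k1 k2 ⊢
  linear_combination (norm := module) k2 - k1

end IsHypersurfaceOn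
end Gauss

/-! ### The Ricci tensor of a hypersurface of a warped product -/

section Ricci

variable {E : Type*} [NormedAddCommGroup E] [NormedSpace ℝ E] [FiniteDimensional ℝ E]
variable {f : ℝ → ℝ} {h G : E → E →L[ℝ] E →L[ℝ] ℝ} {K : Set ℝ} {U U' : Set E}
  {F V : E → ℝ × E} {u : E} {c : ℝ} {A : E →L[ℝ] E} {T : E}

/-- The Gauss equation of a hypersurface in a warped product over an interval with fibre of constant
curvature. Here `A` is the shape operator and `T` the tangential part of `∂_t`, both characterized
by their pairings with tangent vectors. -/
theorem curvature_hypersurface (hK : IsOpen K) (hf : ContDiffOn ℝ ∞ f K)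
    (hfpos : ∀ t ∈ K, 0 < f t) (hh : IsMetricOn h U')
    (hF : IsHypersurfaceOn G (warpedForm f h) F V U (K ×ˢ U')) (hu : u ∈ U)
    (hc : ∀ v w, h (F u).2 (curvature h (F u).2 w w v) v
      = c * (h (F u).2 v v * h (F u).2 w w - h (F u).2 v w ^ 2))
    (hA : ∀ v w, G u (A v) w = -warpedForm f h (F u) (covDeriv (warpedForm f h) F V u v)
      (fderiv ℝ F u w))
    (hT : ∀ w, G u T w = (fderiv ℝ F u w).1) (v w z : E) :
    curvature G u w z v = -(coeffA f c (F u).1 • (G u w z • v - G u v z • w))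
      - coeffB f c (F u).1 • ((G u T w * G u T z) • v - (G u T v * G u T z) • w
        + (G u w z * G u T v - G u v z * G u T w) • T)
      + G u (A w) z • A v - G u (A v) z • A w := by
  have hG := hF.isMetricOn
  have hII : ∀ v w, secondForm (warpedForm f h) F V u v w = G u (A v) w := fun v w ↦ by
    rw [hA, hF.apply_covDeriv hu, neg_neg]
  obtain ⟨s, hs⟩ := hF.exists_curvature_eq hu v w z
  rw [curvature_warpedForm_of_const hK hf hfpos hh (hF.mapsTo hu) hc, ← hF.induced u hu,
    ← hF.induced u hu] at hs
  refine eq_of_forall_apply_eq (hG.pos u hu) fun y ↦ ?_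
  have e := congrArg (fun p ↦ warpedForm f h (F u) p (fderiv ℝ F u y)) hs
  have hdt : warpedForm f h (F u) ((1, 0) : ℝ × E) (fderiv ℝ F u y) = G u T y := by
    rw [warpedForm_apply, hT]
    simp
  have hcd : ∀ v, warpedForm f h (F u) (covDeriv (warpedForm f h) F V u v) (fderiv ℝ F u y)
      = -G u (A v) y := fun v ↦ by rw [hA, neg_neg]
  simp only [map_add, map_sub, map_smul, map_neg, add_apply, sub_apply, smul_apply, neg_apply,
    smul_eq_mul, hcd, hdt, hF.normal u hu, ← hF.induced u hu, ← hT, hII] at e ⊢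
  linear_combination e

/-- The Ricci tensor of a hypersurface in a warped product over an interval with fibre of constant
curvature. -/
theorem trace_curvature_hypersurface (hK : IsOpen K) (hf : ContDiffOn ℝ ∞ f K)
    (hfpos : ∀ t ∈ K, 0 < f t) (hh : IsMetricOn h U')
    (hF : IsHypersurfaceOn G (warpedForm f h) F V U (K ×ˢ U')) (hu : u ∈ U)
    (hc : ∀ v w, h (F u).2 (curvature h (F u).2 w w v) v
      = c * (h (F u).2 v v * h (F u).2 w w - h (F u).2 v w ^ 2))
    (hA : ∀ v w, G u (A v) w = -warpedForm f h (F u) (covDeriv (warpedForm f h) F V u v)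
      (fderiv ℝ F u w))
    (hT : ∀ w, G u T w = (fderiv ℝ F u w).1) (w z : E) :
    LinearMap.trace ℝ E (curvature G u w z).toLinearMap =
      -((Module.finrank ℝ E - 1) * coeffA f c (F u).1 * G u w z)
      - coeffB f c (F u).1 * ((Module.finrank ℝ E - 2) * (G u T w * G u T z)
        + G u T T * G u w z)
      + LinearMap.trace ℝ E A.toLinearMap * G u (A w) z - G u (A (A w)) z := by
  -- a multiple of the identity, a multiple of `A`, and operators of rank one
  have e : (curvature G u w z).toLinearMap =
      (-(coeffA f c (F u).1 * G u w z) - coeffB f c (F u).1 * (G u T w * G u T z)) • LinearMap.id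
      + coeffA f c (F u).1 • ((G u).flip z).toLinearMap.smulRight w
      + (coeffB f c (F u).1 * G u T z) • (G u T).toLinearMap.smulRight w
      - (coeffB f c (F u).1 * G u w z) • (G u T).toLinearMap.smulRight T
      + (coeffB f c (F u).1 * G u T w) • ((G u).flip z).toLinearMap.smulRight T
      + G u (A w) z • A.toLinearMap
      - ((G u).flip z ∘L A).toLinearMap.smulRight (A w) := by
    ext v
    simp only [ContinuousLinearMap.coe_coe, LinearMap.add_apply, LinearMap.sub_apply,
      LinearMap.smul_apply, LinearMap.id_apply, LinearMap.smulRight_apply,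
      ContinuousLinearMap.flip_apply, ContinuousLinearMap.comp_apply]
    rw [curvature_hypersurface hK hf hfpos hh hF hu hc hA hT]
    module
  rw [e]
  simp only [map_add, map_sub, map_smul, LinearMap.trace_smulRight, LinearMap.trace_id,
    ContinuousLinearMap.coe_coe, ContinuousLinearMap.flip_apply, ContinuousLinearMap.comp_apply,
    smul_eq_mul]
  ring

end Ricci

/-! ### Quadratic polynomials of self-adjoint endomorphisms -/

section LinearAlgebra

variable {V : Type*} [AddCommGroup V] [Module ℝ V] [FiniteDimensional ℝ V]

/-- Let `A` be self-adjoint and let `A² - sA + κ` be a non-zero multiple of the orthogonal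
projection onto the line spanned by `T`. Then `T` is an eigenvector of `A`, with a simple eigenvalue
`μ`, and the remaining eigenvalues are the roots of `X² - sX + κ` that occur. -/
theorem exists_eigenvalues {B : V →ₗ[ℝ] V →ₗ[ℝ] ℝ} (hpos : ∀ v, v ≠ 0 → 0 < B v v)
    {A : Module.End ℝ V} (hA : ∀ v w, B (A v) w = B v (A w))
    {T : V} (hT : T ≠ 0) {s κ β : ℝ} (hβ : β ≠ 0) (hdim : 2 ≤ Module.finrank ℝ V)
    (hq : ∀ w, A (A w) - s • A w + κ • w = (-(β * B T w)) • T) :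
    ∃ lam₁ lam₂ μ : ℝ, A.HasEigenvector μ T ∧ {x : ℝ | A.HasEigenvalue x} = {lam₁, lam₂, μ} ∧
      lam₁ ≠ μ ∧ lam₂ ≠ μ ∧ lam₁ ^ 2 - s * lam₁ + κ = 0 ∧ lam₂ ^ 2 - s * lam₂ + κ = 0 ∧
      μ ^ 2 - s * μ + κ + β * B T T = 0 ∧ Module.finrank ℝ (A.eigenspace μ) = 1 := by
  have hTT := hpos T hT
  -- `A` commutes with its polynomial `A² - sA + κ`, hence preserves the line spanned by `T`
  obtain ⟨μ, hμ⟩ : ∃ μ : ℝ, A T = μ • T := by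
    have h1 := congrArg A (hq T)
    have h2 := hq (A T)
    simp only [map_add, map_sub, map_smul] at h1
    rw [h1] at h2
    refine ⟨(β * B T T)⁻¹ * (β * B T (A T)), ?_⟩
    have h3 : (β * B T T) • A T = (β * B T (A T)) • T := by
      rw [neg_smul, neg_smul, neg_inj] at h2
      exact h2
    rw [mul_smul, ← h3, smul_smul, inv_mul_cancel₀ (mul_ne_zero hβ hTT.ne'), one_smul]
  have hμq : μ ^ 2 - s * μ + κ + β * B T T = 0 := by
    have h1 := hq T
    rw [hμ, map_smul, hμ] at h1
    have h2 : (μ ^ 2 - s * μ + κ + β * B T T) • T = 0 := by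
      linear_combination (norm := module) h1
    exact (smul_eq_zero.1 h2).resolve_right hT
  have hTeig : A.HasEigenvector μ T := ⟨Module.End.mem_eigenspace_iff.2 hμ, hT⟩
  -- eigenvectors for other eigenvalues are orthogonal to `T`
  have horth : ∀ {x : ℝ} {v : V}, A v = x • v → x ≠ μ → B T v = 0 := by
    intro x v hv hx
    have h1 := hA T v
    rw [hμ, hv, map_smul, map_smul, LinearMap.smul_apply, smul_eq_mul, smul_eq_mul] at h1
    have h2 : (x - μ) * B T v = 0 := by linarith
    exact (mul_eq_zero.1 h2).resolve_left (sub_ne_zero.2 hx)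
  have hroot : ∀ {x : ℝ} {v : V}, A v = x • v → v ≠ 0 → B T v = 0 → x ^ 2 - s * x + κ = 0 := by
    intro x v hv hv0 hTv
    have h1 := hq v
    rw [hTv, hv, map_smul, hv] at h1
    have h2 : (x ^ 2 - s * x + κ) • v = 0 := by
      linear_combination (norm := module) h1
    exact (smul_eq_zero.1 h2).resolve_right hv0
  have hμroot : ∀ {x : ℝ}, x ^ 2 - s * x + κ = 0 → x ≠ μ := by
    rintro x hx rfl
    have : β * B T T ≠ 0 := mul_ne_zero hβ hTT.ne'
    exact this (by linarith)
  have hsimple : A.eigenspace μ = ℝ ∙ T := by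
    refine le_antisymm (fun v hv ↦ ?_) ?_
    · rw [Module.End.mem_eigenspace_iff] at hv
      rw [Submodule.mem_span_singleton]
      refine ⟨B T v / B T T, ?_⟩
      by_contra hne
      refine hμroot (hroot (x := μ) (v := v - (B T v / B T T) • T) ?_ ?_ ?_) rfl
      · rw [map_sub, map_smul, hv, hμ]
        module
      · exact sub_ne_zero.2 fun h ↦ hne h.symm
      · rw [map_sub, map_smul, smul_eq_mul]
        field_simp
        ring
    · rw [Submodule.span_singleton_le_iff_mem]
      exact hTeig.1
  -- on a non-zero vector orthogonal to `T`, the polynomial `A² - sA + κ` vanishes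
  obtain ⟨w, hw0, hw⟩ : ∃ w, w ≠ 0 ∧ B T w = 0 := by
    have h1 : (B T).ker ≠ ⊥ := by
      intro hbot
      have h2 := (B T).finrank_range_add_finrank_ker
      have h3 := (B T).range.finrank_le
      rw [hbot, finrank_bot] at h2
      rw [Module.finrank_self] at h3
      omega
    obtain ⟨w, hw, hw0⟩ := Submodule.exists_mem_ne_zero_of_ne_bot h1
    exact ⟨w, hw0, hw⟩
  have hAw := hq w
  rw [hw, mul_zero, neg_zero, zero_smul] at hAw
  -- its discriminant is non-negative, as `A - s/2` is self-adjoint with square `s²/4 - κ`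
  have hdisc : 0 ≤ s ^ 2 / 4 - κ := by
    have h1 : 0 ≤ B (A w - (s / 2) • w) (A w - (s / 2) • w) := by
      by_cases h0 : A w - (s / 2) • w = 0
      · rw [h0]; simp
      · exact (hpos _ h0).le
    have h2 : B (A w - (s / 2) • w) (A w - (s / 2) • w) = (s ^ 2 / 4 - κ) * B w w := by
      have h3 := congrArg (B w) hAw
      simp only [map_add, map_sub, map_smul, LinearMap.sub_apply, LinearMap.smul_apply, hA,
        smul_eq_mul, map_zero] at h3 ⊢
      linear_combination h3
    rw [h2] at h1
    exact nonneg_of_mul_nonneg_left h1 (hpos w hw0)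
  obtain ⟨d, hd⟩ : ∃ d, d ^ 2 = s ^ 2 / 4 - κ := ⟨_, Real.sq_sqrt hdisc⟩
  have hfac : ∀ {x : ℝ}, x ^ 2 - s * x + κ = 0 → x = s / 2 + d ∨ x = s / 2 - d := by
    intro x hx
    have h1 : (x - (s / 2 + d)) * (x - (s / 2 - d)) = 0 := by linear_combination hx - hd
    rcases mul_eq_zero.1 h1 with h | h
    · exact Or.inl (sub_eq_zero.1 h)
    · exact Or.inr (sub_eq_zero.1 h)
  -- `(A - (s/2 + d)) (A - (s/2 - d)) w = 0`, so that one of the factors has a kernel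
  have hex : ∃ x : ℝ, x ^ 2 - s * x + κ = 0 ∧ A.HasEigenvalue x := by
    by_cases h0 : A w = (s / 2 - d) • w
    · exact ⟨s / 2 - d, by linear_combination hd,
        Module.End.hasEigenvalue_of_hasEigenvector ⟨Module.End.mem_eigenspace_iff.2 h0, hw0⟩⟩
    · refine ⟨s / 2 + d, by linear_combination hd, Module.End.hasEigenvalue_of_hasEigenvector
        (x := A w - (s / 2 - d) • w) ⟨Module.End.mem_eigenspace_iff.2 ?_, sub_ne_zero.2 h0⟩⟩
      rw [map_sub, map_smul]
      have h1 : d ^ 2 • w = (s ^ 2 / 4 - κ) • w := by rw [hd]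
      linear_combination (norm := module) hAw - h1
  have hcase : ∀ {x : ℝ}, A.HasEigenvalue x → x ≠ μ → x ^ 2 - s * x + κ = 0 := by
    intro x hx hxμ
    obtain ⟨v, hv⟩ := hx.exists_hasEigenvector
    exact hroot hv.apply_eq_smul hv.2 (horth hv.apply_eq_smul hxμ)
  have hμeig : A.HasEigenvalue μ := Module.End.hasEigenvalue_of_hasEigenvector hTeig
  have hfin : Module.finrank ℝ (A.eigenspace μ) = 1 := by
    rw [hsimple, finrank_span_singleton hT]
  obtain ⟨x, hx, hxeig⟩ := hex
  -- if only one root occurs as an eigenvalue, it is listed twice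
  by_cases hy : ∃ y : ℝ, y ≠ x ∧ y ^ 2 - s * y + κ = 0 ∧ A.HasEigenvalue y
  · obtain ⟨y, hyx, hy, hyeig⟩ := hy
    refine ⟨x, y, μ, hTeig, ?_, hμroot hx, hμroot hy, hx, hy, hμq, hfin⟩
    ext z
    simp only [Set.mem_ofPred_eq, Set.mem_insert_iff, Set.mem_singleton_iff]
    constructor
    · intro hz
      by_cases hzμ : z = μ
      · exact Or.inr (Or.inr hzμ)
      · have h1 := hfac (hcase hz hzμ)
        have h2 := hfac hx
        have h3 := hfac hy
        grind
    · rintro (rfl | rfl | rfl) <;> assumption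
  · refine ⟨x, x, μ, hTeig, ?_, hμroot hx, hμroot hx, hx, hx, hμq, hfin⟩
    ext z
    simp only [Set.mem_ofPred_eq, Set.mem_insert_iff, Set.mem_singleton_iff]
    constructor
    · intro hz
      by_cases hzμ : z = μ
      · exact Or.inr (Or.inr hzμ)
      · by_contra hne
        push Not at hne
        exact hy ⟨z, hne.1, hcase hz hzμ, hz⟩
    · rintro (rfl | rfl | rfl) <;> assumption

end LinearAlgebra

/-! ### Metrics in charts -/

section Charts

variable {E : Type*} [NormedAddCommGroup E] [NormedSpace ℝ E]
  {H : Type*} [TopologicalSpace H] {J : ModelWithCorners ℝ E H}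
  {N : Type*} [TopologicalSpace N] [ChartedSpace H N]

/-- The derivative of the inverse of the preferred chart at `x`, as an endomorphism of the model
space. -/
noncomputable def chartSymmDeriv (J : ModelWithCorners ℝ E H) (x : N) (u : E) : E →L[ℝ] E :=
  mfderiv 𝓘(ℝ, E) J (extChartAt J x).symm u

/-- The derivative of the preferred chart at `x`, as an endomorphism of the model space. -/
noncomputable def chartDeriv (J : ModelWithCorners ℝ E H) (x y : N) : E →L[ℝ] E :=
  mfderiv J 𝓘(ℝ, E) (extChartAt J x) y

/-- A field of bilinear forms on the tangent spaces of `N`, read as a field of bilinear forms on the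
model space. -/
def onModel (g : ∀ y : N, TangentSpace J y →L[ℝ] TangentSpace J y →L[ℝ] ℝ) (y : N) :
    E →L[ℝ] E →L[ℝ] ℝ :=
  g y

theorem chartMetric_apply
    (g : ∀ y : N, TangentSpace J y →L[ℝ] TangentSpace J y →L[ℝ] ℝ) (x : N) (u v w : E) :
    chartMetric J g x u v w = onModel g ((extChartAt J x).symm u)
      (chartSymmDeriv J x u v) (chartSymmDeriv J x u w) :=
  rfl

variable [IsManifold J ∞ N]

theorem mdifferentiableAt_extChartAt_of_mem {x y : N} (hy : y ∈ (extChartAt J x).source) :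
    MDifferentiableAt J 𝓘(ℝ, E) (extChartAt J x) y := by
  have : IsManifold J 1 N := IsManifold.of_le (n := ∞) (by simp)
  exact mdifferentiableAt_extChartAt (by rwa [← extChartAt_source (I := J)])

/-- The metric applied to two smooth vector fields along a smooth map is smooth. -/
theorem contDiffOn_inner (h : Bundle.ContMDiffRiemannianMetric J ∞ E
    (fun q : N ↦ TangentSpace J q)) {b : E → N} {s : Set E} {v w : ∀ u, TangentSpace J (b u)}
    (hb : ContMDiffOn 𝓘(ℝ, E) J ∞ b s)
    (hv : ContMDiffOn 𝓘(ℝ, E) J.tangent ∞ (fun u ↦ (⟨b u, v u⟩ : TangentBundle J N)) s)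
    (hw : ContMDiffOn 𝓘(ℝ, E) J.tangent ∞ (fun u ↦ (⟨b u, w u⟩ : TangentBundle J N)) s) :
    ContDiffOn ℝ ∞ (fun u ↦ h.inner (b u) (v u) (w u)) s := by
  have : IsManifold J 1 N := IsManifold.of_le (n := ∞) (by simp)
  rw [← contMDiffOn_iff_contDiffOn]
  intro u hu
  have h4 : ContMDiffWithinAt 𝓘(ℝ, E) (J.prod 𝓘(ℝ, ℝ)) ∞
      (fun u ↦ TotalSpace.mk' ℝ (E := Bundle.Trivial N ℝ) (b u) (h.inner (b u) (v u) (w u)))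
      s u := by
    apply ContMDiffWithinAt.clm_bundle_apply₂ (F₁ := E) (F₂ := E)
    · exact ContMDiffAt.comp_contMDiffWithinAt u h.contMDiff.contMDiffAt (hb u hu)
    · exact hv u hu
    · exact hw u hu
  simp only [contMDiffWithinAt_totalSpace] at h4
  exact h4.2

theorem chartMetric_symm (h : Bundle.ContMDiffRiemannianMetric J ∞ E
    (fun q : N ↦ TangentSpace J q)) (x : N) (u v w : E) :
    chartMetric J h.inner x u v w = chartMetric J h.inner x u w v :=
  h.symm ((extChartAt J x).symm u) (chartSymmDeriv J x u v) (chartSymmDeriv J x u w)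

variable [J.Boundaryless]

theorem contMDiffAt_extChartAt_symm {x : N} {u : E} (hu : u ∈ (extChartAt J x).target) :
    ContMDiffAt 𝓘(ℝ, E) J ∞ (extChartAt J x).symm u :=
  (contMDiffOn_extChartAt_symm x).contMDiffAt ((isOpen_extChartAt_target x).mem_nhds hu)

theorem mdifferentiableAt_extChartAt_symm {x : N} {u : E} (hu : u ∈ (extChartAt J x).target) :
    MDifferentiableAt 𝓘(ℝ, E) J (extChartAt J x).symm u :=
  (contMDiffAt_extChartAt_symm hu).mdifferentiableAt (by simp)

/-- The coordinate vector fields of a chart are smooth. -/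
theorem contMDiffOn_tangentMap_extChartAt_symm (x : N) (e : E) :
    ContMDiffOn 𝓘(ℝ, E) J.tangent ∞
      (fun u : E ↦ tangentMap 𝓘(ℝ, E) J (extChartAt J x).symm ⟨u, e⟩)
      (extChartAt J x).target := by
  have : IsManifold J 1 N := IsManifold.of_le (n := ∞) (by simp)
  have ho := isOpen_extChartAt_target (I := J) x
  have h1 := (contMDiffOn_extChartAt_symm (I := J) (n := ∞) x).contMDiffOn_tangentMapWithin
    (m := ∞) (by simp) ho.uniqueMDiffOn
  have h2 : ContMDiffOn 𝓘(ℝ, E) 𝓘(ℝ, E).tangent ∞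
      (fun u : E ↦ (⟨u, e⟩ : TangentBundle 𝓘(ℝ, E) E)) (extChartAt J x).target :=
    (contMDiffOn_vectorSpace_iff_contDiffOn (V := fun _ ↦ e)).2 contDiffOn_const
  have h3 := h1.comp h2 fun u hu ↦ hu
  exact h3.congr fun u hu ↦ (tangentMapWithin_eq_tangentMap (p := ⟨u, e⟩)
    (ho.uniqueMDiffOn u hu) (mdifferentiableAt_extChartAt_symm hu)).symm

theorem chartDeriv_chartSymmDeriv {x : N} {u : E} (hu : u ∈ (extChartAt J x).target) (v : E) :
    chartDeriv J x ((extChartAt J x).symm u) (chartSymmDeriv J x u v) = v := by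
  have : IsManifold J 1 N := IsManifold.of_le (n := ∞) (by simp)
  have h := mfderiv_extChartAt_comp_mfderivWithin_extChartAt_symm (I := J) hu
  rw [J.range_eq_univ, mfderivWithin_univ] at h
  exact DFunLike.congr_fun h v

theorem chartSymmDeriv_chartDeriv {x y : N} (hy : y ∈ (extChartAt J x).source) (v : E) :
    chartSymmDeriv J x (extChartAt J x y) (chartDeriv J x y v) = v := by
  have : IsManifold J 1 N := IsManifold.of_le (n := ∞) (by simp)
  have h := mfderivWithin_extChartAt_symm_comp_mfderiv_extChartAt' (I := J) hy
  rw [J.range_eq_univ, mfderivWithin_univ] at h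
  exact DFunLike.congr_fun h v

/-- At its base point, the preferred chart has derivative the identity. -/
theorem chartSymmDeriv_self (x : N) :
    chartSymmDeriv J x (extChartAt J x x) = ContinuousLinearMap.id ℝ E := by
  have hu := mem_extChartAt_target (I := J) x
  have e : writtenInExtChartAt 𝓘(ℝ, E) J (extChartAt J x x) (extChartAt J x).symm
      =ᶠ[nhds (extChartAt J x x)] id := by
    filter_upwards [(isOpen_extChartAt_target x).mem_nhds hu] with u hu
    simp only [writtenInExtChartAt, extChartAt_model_space_eq_id, PartialEquiv.refl_symm,
      PartialEquiv.refl_coe, Function.comp_apply, id_eq, extChartAt_to_inv,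
      (extChartAt J x).right_inv hu]
  have h : HasMFDerivAt 𝓘(ℝ, E) J (extChartAt J x).symm (extChartAt J x x)
      (ContinuousLinearMap.id ℝ E) :=
    ⟨(contMDiffAt_extChartAt_symm hu).continuousAt,
      (e.hasFDerivAt_iff.2 (hasFDerivAt_id _)).hasFDerivWithinAt⟩
  exact h.mfderiv

theorem chartDeriv_self (x : N) (v : E) : chartDeriv J x x v = v := by
  have h := chartSymmDeriv_chartDeriv (J := J) (mem_extChartAt_source x) v
  rwa [chartSymmDeriv_self] at h

theorem chartMetric_self (g : ∀ y : N, TangentSpace J y →L[ℝ] TangentSpace J y →L[ℝ] ℝ) (x : N) :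
    chartMetric J g x (extChartAt J x x) = onModel g x := by
  ext v w
  rw [chartMetric_apply, chartSymmDeriv_self, extChartAt_to_inv]
  rfl

theorem contDiffOn_chartMetric_apply (h : Bundle.ContMDiffRiemannianMetric J ∞ E
    (fun q : N ↦ TangentSpace J q)) (x : N) (v w : E) :
    ContDiffOn ℝ ∞ (fun u ↦ chartMetric J h.inner x u v w) (extChartAt J x).target :=
  contDiffOn_inner h (b := (extChartAt J x).symm)
    (v := fun u ↦ mfderiv 𝓘(ℝ, E) J (extChartAt J x).symm u v)
    (w := fun u ↦ mfderiv 𝓘(ℝ, E) J (extChartAt J x).symm u w)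
    (contMDiffOn_extChartAt_symm (I := J) (n := ∞) x)
    (contMDiffOn_tangentMap_extChartAt_symm x v) (contMDiffOn_tangentMap_extChartAt_symm x w)

theorem chartMetric_pos (h : Bundle.ContMDiffRiemannianMetric J ∞ E
    (fun q : N ↦ TangentSpace J q)) (x : N) {u : E} (hu : u ∈ (extChartAt J x).target) {v : E}
    (hv : v ≠ 0) : 0 < chartMetric J h.inner x u v v := by
  refine h.pos ((extChartAt J x).symm u) (chartSymmDeriv J x u v) fun h0 ↦ hv ?_
  have h1 : chartSymmDeriv J x u v = 0 := h0
  rw [← chartDeriv_chartSymmDeriv hu v, h1, map_zero]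

/-- A Riemannian metric is expressed in charts by Riemannian metrics on open sets. -/
theorem isMetricOn_chartMetric [FiniteDimensional ℝ E]
    (h : Bundle.ContMDiffRiemannianMetric J ∞ E (fun q : N ↦ TangentSpace J q)) (x : N) :
    IsMetricOn (chartMetric J h.inner x) (extChartAt J x).target where
  isOpen := isOpen_extChartAt_target x
  contDiffOn := by
    simp only [contDiffOn_clm_apply]
    exact fun v w ↦ contDiffOn_chartMetric_apply h x v w
  symm u _ v w := chartMetric_symm h x u v w
  pos _ hu _ hv := chartMetric_pos h x hu hv

end Charts

/-! ### Hypersurfaces in charts -/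

section HypersurfaceCharts

variable {E : Type*} [NormedAddCommGroup E] [NormedSpace ℝ E]
  {H : Type*} [TopologicalSpace H] {I : ModelWithCorners ℝ E H}
  {M : Type*} [TopologicalSpace M] [ChartedSpace H M]
  {E' : Type*} [NormedAddCommGroup E'] [NormedSpace ℝ E']
  {H' : Type*} [TopologicalSpace H'] {J : ModelWithCorners ℝ E' H'}
  {N : Type*} [TopologicalSpace N] [ChartedSpace H' N]
  {g : ∀ y : N, TangentSpace J y →L[ℝ] TangentSpace J y →L[ℝ] ℝ} {χ : M → N}
  {ν : ∀ x : M, TangentSpace J (χ x)}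

/-- The derivative of `χ`, as a linear map between the model spaces. -/
noncomputable def modelDeriv (I : ModelWithCorners ℝ E H) (J : ModelWithCorners ℝ E' H')
    (χ : M → N) (x : M) : E →L[ℝ] E' :=
  mfderiv I J χ x

/-- The domain of the expression of `χ` in the preferred charts at `x` and `χ x`. -/
def chartDomain (I : ModelWithCorners ℝ E H) (J : ModelWithCorners ℝ E' H') (χ : M → N) (x : M) :
    Set E :=
  (extChartAt I x).target ∩ (extChartAt I x).symm ⁻¹' (χ ⁻¹' (extChartAt J (χ x)).source)

/-- The expression of a vector field along `χ` in the preferred charts at `x` and `χ x`. -/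
noncomputable def chartField (I : ModelWithCorners ℝ E H) (J : ModelWithCorners ℝ E' H')
    (χ : M → N) (ν : ∀ x : M, TangentSpace J (χ x)) (x : M) (u : E) : E' :=
  chartDeriv J (χ x) (χ ((extChartAt I x).symm u)) (ν ((extChartAt I x).symm u))

theorem covariantDerivAlong_eq (x : M) (v : E) :
    covariantDerivAlong I J g χ ν x v = covDeriv (chartMetric J g (χ x))
      (writtenInExtChartAt I J x χ) (chartField I J χ ν x) (extChartAt I x x) v :=
  rfl

theorem mem_chartDomain_self (x : M) : extChartAt I x x ∈ chartDomain I J χ x := by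
  refine ⟨mem_extChartAt_target x, ?_⟩
  rw [Set.mem_preimage, extChartAt_to_inv]
  exact mem_extChartAt_source (χ x)

theorem isOpen_chartDomain [I.Boundaryless] (hχ : Continuous χ) (x : M) : IsOpen (chartDomain I J χ x) :=
  (continuousOn_extChartAt_symm x).isOpen_inter_preimage (isOpen_extChartAt_target x)
    ((isOpen_extChartAt_source (χ x)).preimage hχ)

variable [IsManifold J ∞ N]

/-- In charts, pairing with the ambient metric amounts to pairing on the manifold. -/
theorem chartMetric_chartDeriv [J.Boundaryless] {x : M} {u : E} (hu : u ∈ chartDomain I J χ x) (ξ η : E') :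
    chartMetric J g (χ x) (writtenInExtChartAt I J x χ u)
      (chartDeriv J (χ x) (χ ((extChartAt I x).symm u)) ξ)
      (chartDeriv J (χ x) (χ ((extChartAt I x).symm u)) η)
      = onModel g (χ ((extChartAt I x).symm u)) ξ η := by
  have e : writtenInExtChartAt I J x χ u = extChartAt J (χ x) (χ ((extChartAt I x).symm u)) := rfl
  rw [chartMetric_apply, e, chartSymmDeriv_chartDeriv hu.2, chartSymmDeriv_chartDeriv hu.2,
    (extChartAt J (χ x)).left_inv hu.2]

variable [IsManifold I ∞ M]

theorem contDiffOn_writtenInExtChartAt (hχ : ContMDiff I J ∞ χ) (x : M) :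
    ContDiffOn ℝ ∞ (writtenInExtChartAt I J x χ) (chartDomain I J χ x) := by
  rw [← contMDiffOn_iff_contDiffOn]
  have h1 := hχ.comp_contMDiffOn ((contMDiffOn_extChartAt_symm (I := I) (n := ∞) x).mono
    (Set.inter_subset_left : chartDomain I J χ x ⊆ _))
  have h2 : ContMDiffOn J 𝓘(ℝ, E') ∞ (extChartAt J (χ x)) (extChartAt J (χ x)).source := by
    rw [extChartAt_source]
    exact contMDiffOn_extChartAt
  exact h2.comp h1 fun u hu ↦ hu.2

theorem contDiffOn_chartField
    (hν : haveI : IsManifold J 1 N := IsManifold.of_le (n := ∞) (by simp)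
      ContMDiff I J.tangent ∞ (fun x : M ↦ (⟨χ x, ν x⟩ : TangentBundle J N))) (x : M) :
    ContDiffOn ℝ ∞ (chartField I J χ ν x) (chartDomain I J χ x) := by
  have : IsManifold J 1 N := IsManifold.of_le (n := ∞) (by simp)
  have ho := isOpen_extChartAt_source (I := J) (χ x)
  have h0 : ContMDiffOn J 𝓘(ℝ, E') ∞ (extChartAt J (χ x)) (extChartAt J (χ x)).source := by
    rw [extChartAt_source]
    exact contMDiffOn_extChartAt
  have h1 := h0.contMDiffOn_tangentMapWithin (m := ∞) (by simp) ho.uniqueMDiffOn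
  have h2 := hν.comp_contMDiffOn ((contMDiffOn_extChartAt_symm (I := I) (n := ∞) x).mono
    (Set.inter_subset_left : chartDomain I J χ x ⊆ _))
  have h3 := h1.comp h2 fun u hu ↦ hu.2
  have h4 := (contMDiff_snd_tangentBundle_modelSpace E' 𝓘(ℝ, E') (n := ∞)).comp_contMDiffOn h3
  rw [← contMDiffOn_iff_contDiffOn]
  refine h4.congr fun u hu ↦ ?_
  have h5 := tangentMapWithin_eq_tangentMap
    (p := (⟨χ ((extChartAt I x).symm u), ν ((extChartAt I x).symm u)⟩ : TangentBundle J N))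
    (ho.uniqueMDiffOn _ hu.2) (mdifferentiableAt_extChartAt_of_mem hu.2)
  exact congrArg (fun p : TangentBundle 𝓘(ℝ, E') E' ↦ (p.2 : E')) h5.symm

variable [I.Boundaryless]

theorem fderiv_writtenInExtChartAt (hχ : ContMDiff I J ∞ χ) {x : M} {u : E}
    (hu : u ∈ chartDomain I J χ x) (v : E) :
    fderiv ℝ (writtenInExtChartAt I J x χ) u v =
      chartDeriv J (χ x) (χ ((extChartAt I x).symm u))
        (modelDeriv I J χ ((extChartAt I x).symm u) (chartSymmDeriv I x u v)) := by
  have h1 := (mdifferentiableAt_extChartAt_symm hu.1).hasMFDerivAt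
  have h2 := ((hχ ((extChartAt I x).symm u)).mdifferentiableAt (by simp)).hasMFDerivAt
  have h3 := (mdifferentiableAt_extChartAt_of_mem hu.2).hasMFDerivAt
  obtain ⟨L, hL⟩ : ∃ L : E →L[ℝ] E', L = chartDeriv J (χ x) (χ ((extChartAt I x).symm u)) ∘L
      (modelDeriv I J χ ((extChartAt I x).symm u) ∘L chartSymmDeriv I x u) := ⟨_, rfl⟩
  have h4 : HasMFDerivAt 𝓘(ℝ, E) 𝓘(ℝ, E') (writtenInExtChartAt I J x χ) u L := by
    rw [hL]
    exact h3.comp u (h2.comp u h1)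
  have h5 : HasFDerivAt (writtenInExtChartAt I J x χ) L u := hasMFDerivAt_iff_hasFDerivAt.1 h4
  rw [h5.fderiv, hL]
  rfl

variable [J.Boundaryless]

/-- An immersed hypersurface is expressed in charts by immersed hypersurfaces of open sets. -/
theorem isHypersurfaceOn_chart (hχ : ContMDiff I J ∞ χ)
    (himm : ∀ x, Function.Injective (mfderiv I J χ x))
    (hν : haveI : IsManifold J 1 N := IsManifold.of_le (n := ∞) (by simp)
      IsUnitNormal I J g χ ν)
    (hdim : Module.finrank ℝ E' = Module.finrank ℝ E + 1) {x : M} {U' : Set E'}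
    (hU' : IsMetricOn (chartMetric J g (χ x)) U')
    (hmaps : Set.MapsTo (writtenInExtChartAt I J x χ) (chartDomain I J χ x) U') :
    IsHypersurfaceOn (chartMetric I (inducedMetric I J g χ) x) (chartMetric J g (χ x))
      (writtenInExtChartAt I J x χ) (chartField I J χ ν x) (chartDomain I J χ x) U' where
  ambient := hU'
  isOpen := isOpen_chartDomain hχ.continuous x
  mapsTo := hmaps
  contDiffOn := contDiffOn_writtenInExtChartAt hχ x
  contDiffOn_normal := contDiffOn_chartField hν.smooth x
  injective u hu v w hvw := by
    rw [fderiv_writtenInExtChartAt hχ hu, fderiv_writtenInExtChartAt hχ hu] at hvw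
    have h1 := congrArg (chartSymmDeriv J (χ x) (extChartAt J (χ x) (χ ((extChartAt I x).symm u))))
      hvw
    rw [chartSymmDeriv_chartDeriv hu.2, chartSymmDeriv_chartDeriv hu.2] at h1
    have h2 : chartSymmDeriv I x u v = chartSymmDeriv I x u w := himm _ h1
    rw [← chartDeriv_chartSymmDeriv hu.1 v, h2, chartDeriv_chartSymmDeriv hu.1]
  induced u hu v w := by
    rw [fderiv_writtenInExtChartAt hχ hu, fderiv_writtenInExtChartAt hχ hu,
      chartMetric_chartDeriv hu]
    rfl
  unit u hu := (chartMetric_chartDeriv hu _ _).trans (hν.unit _)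
  normal u hu v := by
    rw [fderiv_writtenInExtChartAt hχ hu]
    exact (chartMetric_chartDeriv hu _ _).trans (hν.normal _ _)
  finrank_eq := hdim

theorem fderiv_writtenInExtChartAt_self (hχ : ContMDiff I J ∞ χ) (x : M) (v : E) :
    fderiv ℝ (writtenInExtChartAt I J x χ) (extChartAt I x x) v = modelDeriv I J χ x v := by
  rw [fderiv_writtenInExtChartAt hχ (mem_chartDomain_self x), chartSymmDeriv_self,
    extChartAt_to_inv, chartDeriv_self]
  rfl

end HypersurfaceCharts

/-! ### Warped products in charts -/

section WarpedCharts

variable {E : Type*} [NormedAddCommGroup E] [NormedSpace ℝ E]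
  {H : Type*} [TopologicalSpace H] {J : ModelWithCorners ℝ E H}
  {Q : Type*} [TopologicalSpace Q] [ChartedSpace H Q]

theorem extChartAt_warped (p : ℝ × Q) (y : ℝ × Q) :
    extChartAt (𝓘(ℝ, ℝ).prod J) p y = (y.1, extChartAt J p.2 y.2) := by
  rw [extChartAt_prod]
  rfl

theorem extChartAt_warped_symm (p : ℝ × Q) (u : ℝ × E) :
    (extChartAt (𝓘(ℝ, ℝ).prod J) p).symm u = (u.1, (extChartAt J p.2).symm u.2) := by
  rw [extChartAt_prod]
  rfl

variable [J.Boundaryless] [IsManifold J ∞ Q]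

theorem chartSymmDeriv_warped (p : ℝ × Q) {u : ℝ × E} (hu : u.2 ∈ (extChartAt J p.2).target)
    (v : ℝ × E) : chartSymmDeriv (𝓘(ℝ, ℝ).prod J) p u v = (v.1, chartSymmDeriv J p.2 u.2 v.2) := by
  have h1 : HasMFDerivAt 𝓘(ℝ, ℝ × E) 𝓘(ℝ, ℝ) (fun u : ℝ × E ↦ u.1) u
      (ContinuousLinearMap.fst ℝ ℝ E) := hasFDerivAt_fst.hasMFDerivAt
  have h2 : HasMFDerivAt 𝓘(ℝ, ℝ × E) 𝓘(ℝ, E) (fun u : ℝ × E ↦ u.2) u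
      (ContinuousLinearMap.snd ℝ ℝ E) := hasFDerivAt_snd.hasMFDerivAt
  have h3 := (mdifferentiableAt_extChartAt_symm hu).hasMFDerivAt.comp u h2
  have h4 := (h1.prodMk h3).mfderiv
  have e : ((extChartAt (𝓘(ℝ, ℝ).prod J) p).symm : ℝ × E → ℝ × Q)
      = fun u ↦ (u.1, (extChartAt J p.2).symm u.2) := funext fun u ↦ extChartAt_warped_symm p u
  unfold chartSymmDeriv
  rw [e]
  exact DFunLike.congr_fun h4 v

theorem chartMetric_warpedMetric (f : ℝ → ℝ)
    (h : ∀ q : Q, TangentSpace J q →L[ℝ] TangentSpace J q →L[ℝ] ℝ) (p : ℝ × Q) {u : ℝ × E}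
    (hu : u.2 ∈ (extChartAt J p.2).target) :
    chartMetric (𝓘(ℝ, ℝ).prod J) (warpedMetric J f h) p u
      = warpedForm f (chartMetric J h p.2) u := by
  refine ContinuousLinearMap.ext fun v ↦ ContinuousLinearMap.ext fun w ↦ ?_
  rw [chartMetric_apply, chartSymmDeriv_warped p hu, chartSymmDeriv_warped p hu,
    extChartAt_warped_symm]
  rfl

end WarpedCharts

/-! ### Replacing the ambient metric on an open set -/

section Congruence

variable {E : Type*} [NormedAddCommGroup E] [NormedSpace ℝ E]
  {E' : Type*} [NormedAddCommGroup E'] [NormedSpace ℝ E']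

theorem christoffel_congr {G₁ G₂ : E → E →L[ℝ] E →L[ℝ] ℝ} {u : E} (h : G₁ =ᶠ[nhds u] G₂) :
    christoffel G₁ u = christoffel G₂ u := by
  have h1 : christoffelFirst G₁ u = christoffelFirst G₂ u := by
    unfold christoffelFirst
    rw [h.fderiv_eq]
  unfold christoffel
  rw [h1, h.eq_of_nhds]

theorem IsMetricOn.congr {G₁ G₂ : E → E →L[ℝ] E →L[ℝ] ℝ} {U : Set E} (h : IsMetricOn G₁ U)
    (he : ∀ u ∈ U, G₂ u = G₁ u) : IsMetricOn G₂ U where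
  isOpen := h.isOpen
  contDiffOn := h.contDiffOn.congr he
  symm u hu v w := by rw [he u hu, h.symm u hu]
  pos u hu v hv := by rw [he u hu]; exact h.pos u hu v hv

theorem IsHypersurfaceOn.congr_ambient {G : E → E →L[ℝ] E →L[ℝ] ℝ}
    {G₁ G₂ : E' → E' →L[ℝ] E' →L[ℝ] ℝ} {F V : E → E'} {U : Set E} {U' : Set E'}
    (h : IsHypersurfaceOn G G₁ F V U U') (he : ∀ y ∈ U', G₂ y = G₁ y) :
    IsHypersurfaceOn G G₂ F V U U' where
  ambient := h.ambient.congr he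
  isOpen := h.isOpen
  mapsTo := h.mapsTo
  contDiffOn := h.contDiffOn
  contDiffOn_normal := h.contDiffOn_normal
  injective := h.injective
  induced u hu v w := by rw [he _ (h.mapsTo hu), h.induced u hu]
  unit u hu := by rw [he _ (h.mapsTo hu), h.unit u hu]
  normal u hu v := by rw [he _ (h.mapsTo hu), h.normal u hu]
  finrank_eq := h.finrank_eq

end Congruence

/-! ### The shape operator in charts -/

section ShapeOperator

variable {E : Type*} [NormedAddCommGroup E] [NormedSpace ℝ E] [FiniteDimensional ℝ E]
  {H : Type*} [TopologicalSpace H] {I : ModelWithCorners ℝ E H}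
  {M : Type*} [TopologicalSpace M] [ChartedSpace H M]
  {E' : Type*} [NormedAddCommGroup E'] [NormedSpace ℝ E']
  {H' : Type*} [TopologicalSpace H'] {J : ModelWithCorners ℝ E' H'}
  {N : Type*} [TopologicalSpace N] [ChartedSpace H' N]
  {g : ∀ y : N, TangentSpace J y →L[ℝ] TangentSpace J y →L[ℝ] ℝ} {χ : M → N}
  {ν : ∀ x : M, TangentSpace J (χ x)}

/-- The defining property of the tangential projection. -/
theorem onModel_tangentialPart {x : M}
    (hpos : ∀ v, v ≠ 0 → 0 < onModel (inducedMetric I J g χ) x v v) (ξ : E') (w : E) :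
    onModel (inducedMetric I J g χ) x (tangentialPart I J g χ x ξ) w
      = onModel g (χ x) ξ (modelDeriv I J χ x w) :=
  DFunLike.congr_fun (apply_inverse_apply hpos
    ((onModel g (χ x)).bilinearComp (ContinuousLinearMap.id ℝ E') (modelDeriv I J χ x) ξ)) w

variable [IsManifold I ∞ M] [I.Boundaryless] [IsManifold J ∞ N] [J.Boundaryless]
  {x : M} {U' : Set E'} {G' : E' → E' →L[ℝ] E' →L[ℝ] ℝ}

/-- The tangential projection at the base point, in terms of the expression of `χ` in charts.
The ambient metric `G'` only has to agree with the metric of the chart on `U'`. -/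
theorem chartMetric_tangentialPart (hχ : ContMDiff I J ∞ χ)
    (heq : ∀ y ∈ U', G' y = chartMetric J g (χ x) y)
    (hF : IsHypersurfaceOn (chartMetric I (inducedMetric I J g χ) x) G'
      (writtenInExtChartAt I J x χ) (chartField I J χ ν x) (chartDomain I J χ x) U')
    (ξ : E') (w : E) :
    chartMetric I (inducedMetric I J g χ) x (extChartAt I x x) (tangentialPart I J g χ x ξ) w
      = G' (writtenInExtChartAt I J x χ (extChartAt I x x)) ξ
        (fderiv ℝ (writtenInExtChartAt I J x χ) (extChartAt I x x) w) := by
  have hu := mem_chartDomain_self (I := I) (J := J) (χ := χ) x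
  have e : writtenInExtChartAt I J x χ (extChartAt I x x) = extChartAt J (χ x) (χ x) :=
    congrArg (fun y ↦ extChartAt J (χ x) (χ y)) (extChartAt_to_inv x)
  have hpos := hF.isMetricOn.pos _ hu
  rw [chartMetric_self] at hpos ⊢
  rw [heq _ (hF.mapsTo hu), e, chartMetric_self, fderiv_writtenInExtChartAt_self hχ]
  exact onModel_tangentialPart hpos ξ w

/-- The shape operator at the base point, in terms of the expressions of `χ` and `ν` in charts. -/
theorem chartMetric_shapeOperator (hχ : ContMDiff I J ∞ χ)
    (heq : ∀ y ∈ U', G' y = chartMetric J g (χ x) y)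
    (hF : IsHypersurfaceOn (chartMetric I (inducedMetric I J g χ) x) G'
      (writtenInExtChartAt I J x χ) (chartField I J χ ν x) (chartDomain I J χ x) U')
    {A : E →L[ℝ] E} (hA : A = shapeOperator I J g χ ν x) (v w : E) :
    chartMetric I (inducedMetric I J g χ) x (extChartAt I x x) (A v) w
      = -G' (writtenInExtChartAt I J x χ (extChartAt I x x))
        (covDeriv G' (writtenInExtChartAt I J x χ) (chartField I J χ ν x) (extChartAt I x x) v)
        (fderiv ℝ (writtenInExtChartAt I J x χ) (extChartAt I x x) w) := by
  have hu := mem_chartDomain_self (I := I) (J := J) (χ := χ) x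
  have hcov : covDeriv G' (writtenInExtChartAt I J x χ) (chartField I J χ ν x) (extChartAt I x x) v
      = covariantDerivAlong I J g χ ν x v := by
    rw [covariantDerivAlong_eq, covDeriv, covDeriv, christoffel_congr]
    filter_upwards [hF.ambient.isOpen.mem_nhds (hF.mapsTo hu)] with y hy using heq y hy
  obtain ⟨y, hy⟩ : ∃ y : E, y = tangentialPart I J g χ x (covariantDerivAlong I J g χ ν x v) :=
    ⟨_, rfl⟩
  have h1 : A v = -y := by
    rw [hA, hy]
    rfl
  rw [h1, map_neg, neg_apply, hcov, hy]
  exact congrArg Neg.neg (chartMetric_tangentialPart hχ heq hF _ w)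

end ShapeOperator

/-! ### The Ricci tensor on the manifold -/

section Einstein

variable {E : Type*} [NormedAddCommGroup E] [NormedSpace ℝ E] [FiniteDimensional ℝ E]
  {H : Type*} [TopologicalSpace H] {I : ModelWithCorners ℝ E H} [I.Boundaryless]
  {M : Type*} [TopologicalSpace M] [ChartedSpace H M] [IsManifold I ∞ M]
  {Q : Type*} [TopologicalSpace Q] [ChartedSpace H Q] [IsManifold I ∞ Q]

/-- A hypersurface of `K ×_f Q` in charts, where the ambient metric is a warped product. -/
theorem isHypersurfaceOn_warped {K : Set ℝ} (hK : IsOpen K) {f : ℝ → ℝ} (hf : ContDiffOn ℝ ∞ f K)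
    (hfpos : ∀ t ∈ K, 0 < f t)
    (h : Bundle.ContMDiffRiemannianMetric I ∞ E (fun q : Q ↦ TangentSpace I q))
    {χ : M → ℝ × Q} (hχK : ∀ x, (χ x).1 ∈ K)
    (hχ : ContMDiff I (𝓘(ℝ, ℝ).prod I) ∞ χ)
    (himm : ∀ x, Function.Injective (mfderiv I (𝓘(ℝ, ℝ).prod I) χ x))
    {ν : ∀ x : M, TangentSpace (𝓘(ℝ, ℝ).prod I) (χ x)}
    (hν : haveI : IsManifold (𝓘(ℝ, ℝ).prod I) 1 (ℝ × Q) := IsManifold.of_le (n := ∞) (by simp)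
      IsUnitNormal I (𝓘(ℝ, ℝ).prod I) (warpedMetric I f h.inner) χ ν) (x : M) :
    IsHypersurfaceOn
      (chartMetric I (inducedMetric I (𝓘(ℝ, ℝ).prod I) (warpedMetric I f h.inner) χ) x)
      (warpedForm f (chartMetric I h.inner (χ x).2)) (writtenInExtChartAt I (𝓘(ℝ, ℝ).prod I) x χ)
      (chartField I (𝓘(ℝ, ℝ).prod I) χ ν x) (chartDomain I (𝓘(ℝ, ℝ).prod I) χ x)
      (K ×ˢ (extChartAt I (χ x).2).target) := by
  have hmet := isMetricOn_warpedForm hK hf hfpos (isMetricOn_chartMetric h (χ x).2)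
  have heq : ∀ y ∈ K ×ˢ (extChartAt I (χ x).2).target,
      chartMetric (𝓘(ℝ, ℝ).prod I) (warpedMetric I f h.inner) (χ x) y
        = warpedForm f (chartMetric I h.inner (χ x).2) y := fun y hy ↦
    chartMetric_warpedMetric f h.inner (χ x) hy.2
  have hmaps : Set.MapsTo (writtenInExtChartAt I (𝓘(ℝ, ℝ).prod I) x χ)
      (chartDomain I (𝓘(ℝ, ℝ).prod I) χ x) (K ×ˢ (extChartAt I (χ x).2).target) := by
    intro v hv
    have h1 := (extChartAt (𝓘(ℝ, ℝ).prod I) (χ x)).map_source hv.2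
    rw [extChartAt_prod] at h1
    have h2 : writtenInExtChartAt I (𝓘(ℝ, ℝ).prod I) x χ v
        = ((χ ((extChartAt I x).symm v)).1,
          extChartAt I (χ x).2 (χ ((extChartAt I x).symm v)).2) := extChartAt_warped _ _
    rw [h2]
    exact ⟨hχK _, h1.2⟩
  have hdim : Module.finrank ℝ (ℝ × E) = Module.finrank ℝ E + 1 := by
    rw [Module.finrank_prod, Module.finrank_self, add_comm]
  exact (isHypersurfaceOn_chart hχ himm hν hdim (hmet.congr heq) hmaps).congr_ambient
    fun y hy ↦ (heq y hy).symm

/-- The Ricci tensor of a hypersurface `χ : M → K ×_f Q`, for a fibre `Q` of constant curvature: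
`Ric = nH A - A² - ((n - 1) a + |T|² b) - (n - 2) b T ⊗ T`, together with the positivity of
the induced metric and the self-adjointness of the shape operator. -/
theorem ricci_warped {K : Set ℝ} (hK : IsOpen K) {f : ℝ → ℝ} (hf : ContDiffOn ℝ ∞ f K)
    (hfpos : ∀ t ∈ K, 0 < f t) {c : ℝ}
    (h : Bundle.ContMDiffRiemannianMetric I ∞ E (fun q : Q ↦ TangentSpace I q))
    (hQ : HasConstantSectionalCurvature I h.inner c) {χ : M → ℝ × Q} (hχK : ∀ x, (χ x).1 ∈ K)
    (hχ : ContMDiff I (𝓘(ℝ, ℝ).prod I) ∞ χ)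
    (himm : ∀ x, Function.Injective (mfderiv I (𝓘(ℝ, ℝ).prod I) χ x))
    {ν : ∀ x : M, TangentSpace (𝓘(ℝ, ℝ).prod I) (χ x)}
    (hν : haveI : IsManifold (𝓘(ℝ, ℝ).prod I) 1 (ℝ × Q) := IsManifold.of_le (n := ∞) (by simp)
      IsUnitNormal I (𝓘(ℝ, ℝ).prod I) (warpedMetric I f h.inner) χ ν) (x : M)
    {B : E →L[ℝ] E →L[ℝ] ℝ}
    (hB : B = onModel (inducedMetric I (𝓘(ℝ, ℝ).prod I) (warpedMetric I f h.inner) χ) x)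
    {A : E →L[ℝ] E}
    (hA : A = shapeOperator I (𝓘(ℝ, ℝ).prod I) (warpedMetric I f h.inner) χ ν x)
    {T : E} (hT : T = tangentialPart I (𝓘(ℝ, ℝ).prod I) (warpedMetric I f h.inner) χ x
      (dt I (χ x))) :
    (∀ v, v ≠ 0 → 0 < B v v) ∧ (∀ v w, B (A v) w = B v (A w)) ∧
    ∀ w z : E, LinearMap.trace ℝ E (curvature (chartMetric I (inducedMetric I (𝓘(ℝ, ℝ).prod I)
        (warpedMetric I f h.inner) χ) x) (extChartAt I x x) w z).toLinearMap =
      -((Module.finrank ℝ E - 1) * coeffA f c (χ x).1 * B w z)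
      - coeffB f c (χ x).1 * ((Module.finrank ℝ E - 2) * (B T w * B T z) + B T T * B w z)
      + LinearMap.trace ℝ E A.toLinearMap * B (A w) z - B (A (A w)) z := by
  have hh := isMetricOn_chartMetric h (χ x).2
  have heq : ∀ y ∈ K ×ˢ (extChartAt I (χ x).2).target,
      warpedForm f (chartMetric I h.inner (χ x).2) y
        = chartMetric (𝓘(ℝ, ℝ).prod I) (warpedMetric I f h.inner) (χ x) y := fun y hy ↦
    (chartMetric_warpedMetric f h.inner (χ x) hy.2).symm
  have hF := isHypersurfaceOn_warped hK hf hfpos h hχK hχ himm hν x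
  have hu := mem_chartDomain_self (I := I) (J := 𝓘(ℝ, ℝ).prod I) (χ := χ) x
  have hAw := chartMetric_shapeOperator hχ heq hF hA
  have hTw : ∀ w, chartMetric I (inducedMetric I (𝓘(ℝ, ℝ).prod I) (warpedMetric I f h.inner) χ) x
      (extChartAt I x x) T w
      = (fderiv ℝ (writtenInExtChartAt I (𝓘(ℝ, ℝ).prod I) x χ) (extChartAt I x x) w).1 := by
    intro w
    rw [hT]
    refine (chartMetric_tangentialPart hχ heq hF (1, 0) w).trans ?_
    rw [warpedForm_apply]
    simp
  have hFu : writtenInExtChartAt I (𝓘(ℝ, ℝ).prod I) x χ (extChartAt I x x)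
      = ((χ x).1, extChartAt I (χ x).2 (χ x).2) :=
    (congrArg (fun y ↦ extChartAt (𝓘(ℝ, ℝ).prod I) (χ x) (χ y)) (extChartAt_to_inv x)).trans
      (extChartAt_warped _ _)
  have hBG := (chartMetric_self (inducedMetric I (𝓘(ℝ, ℝ).prod I) (warpedMetric I f h.inner) χ)
    x).trans hB.symm
  have hM := hF.isMetricOn
  have hself := fun v w ↦ (hAw v w).trans (by rw [hF.apply_covDeriv hu, neg_neg])
  have htr := trace_curvature_hypersurface hK hf hfpos hh hF hu (c := c) (A := A) (T := T)
    (fun v w ↦ by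
      have h1 := chartMetric_self h.inner (χ x).2
      rw [hFu, h1]
      exact hQ (χ x).2 v w) hAw hTw
  rw [hFu] at htr
  have hpos := hM.pos _ hu
  have hsymm := hM.symm _ hu
  have hadj : ∀ v w, chartMetric I (inducedMetric I (𝓘(ℝ, ℝ).prod I) (warpedMetric I f h.inner) χ)
      x (extChartAt I x x) (A v) w = chartMetric I (inducedMetric I (𝓘(ℝ, ℝ).prod I)
      (warpedMetric I f h.inner) χ) x (extChartAt I x x) v (A w) := fun v w ↦ by
    rw [hself v w, hF.secondForm_symm hu, ← hself w v, hsymm]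
  -- at the base point, the chart identifies the tangent space with `E`
  rw [hBG] at htr hpos hadj
  exact ⟨hpos, hadj, htr⟩

end Einstein

/-! ### Principal curvatures -/

section Conclusion

variable {E : Type*} [NormedAddCommGroup E] [NormedSpace ℝ E] [FiniteDimensional ℝ E]

/-- The pointwise algebra behind the theorem: the eigenvalues of a self-adjoint endomorphism `A`
satisfying `Ric = ρ`, where `Ric` is given by the Gauss equation. -/
theorem exists_principal_curvatures {n : ℕ} (hn : 3 ≤ n) (hE : Module.finrank ℝ E = n)
    {B : E →L[ℝ] E →L[ℝ] ℝ} (hpos : ∀ v, v ≠ 0 → 0 < B v v) {A : Module.End ℝ E}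
    (hA : ∀ v w, B (A v) w = B v (A w)) {T : E} (hT : T ≠ 0) {a b ρ s : ℝ} (hb : b ≠ 0)
    (hric : ∀ w z, -((n - 1) * a * B w z) - b * ((n - 2) * (B T w * B T z) + B T T * B w z)
      + s * B (A w) z - B (A (A w)) z = ρ * B w z) :
    ∃ lam₁ lam₂ lamn : ℝ,
      A.HasEigenvector lamn T ∧
      {μ : ℝ | A.HasEigenvalue μ} = {lam₁, lam₂, lamn} ∧
      lam₁ ≠ lamn ∧ lam₂ ≠ lamn ∧
      2 ≤ {μ : ℝ | A.HasEigenvalue μ}.ncard ∧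
      {μ : ℝ | A.HasEigenvalue μ}.ncard ≤ 3 ∧
      lam₁ ^ 2 - s * lam₁ + ρ + (n - 1) * a + B T T * b = 0 ∧
      lam₂ ^ 2 - s * lam₂ + ρ + (n - 1) * a + B T T * b = 0 ∧
      lamn ^ 2 - s * lamn + ρ + (n - 1) * (a + B T T * b) = 0 ∧
      Module.finrank ℝ (A.eigenspace lamn) = 1 := by
  have hn' : ((n : ℝ) - 2) * b ≠ 0 := by
    have : (3 : ℝ) ≤ n := by exact_mod_cast hn
    exact mul_ne_zero (by linarith) hb
  obtain ⟨lam₁, lam₂, lamn, h1, h2, h3, h4, h5, h6, h7, h8⟩ :=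
    exists_eigenvalues (B := B.toLinearMap₁₂) (A := A) (T := T) (s := s)
      (κ := ρ + (n - 1) * a + B T T * b) (β := (n - 2) * b) hpos hA hT hn' (by omega) (by
        intro w
        refine eq_of_forall_apply_eq hpos fun z ↦ ?_
        change B (A (A w) - s • A w + (ρ + (n - 1) * a + B T T * b) • w) z
          = B ((-((n - 2) * b * B T w)) • T) z
        have h1 := hric w z
        simp only [map_add, map_sub, map_smul, add_apply, sub_apply, smul_apply, smul_eq_mul]
        linarith)
  replace h7 : lamn ^ 2 - s * lamn + (ρ + (n - 1) * a + B T T * b) + (n - 2) * b * B T T = 0 := h7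
  refine ⟨lam₁, lam₂, lamn, h1, h2, h3, h4, ?_, ?_, by linarith, by linarith, by linarith, h8⟩
  · rw [h2, ← Set.ncard_pair h3]
    exact Set.ncard_le_ncard (by grind) (Set.toFinite _)
  · rw [h2]
    refine (Set.ncard_insert_le _ _).trans ?_
    have := Set.ncard_insert_le lam₂ {lamn}
    rw [Set.ncard_singleton] at this
    omega

end Conclusion
end WarpedHypersurface

theorem mainTheorem5 {n : ℕ} (hn : 4 ≤ n)
    -- the base interval, the warping function and the curvature of the fibre
    {K : Set ℝ} (hK : IsOpen K) (hKc : K.OrdConnected)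
    {f : ℝ → ℝ} (hf : ContDiffOn ℝ ∞ f K) (hfpos : ∀ t ∈ K, 0 < f t)
    {c : ℝ} (hc : c = -1 ∨ c = 0 ∨ c = 1)
    -- the fibre: an `n`-dimensional Riemannian manifold of constant sectional curvature `c`
    {Q : Type*} [TopologicalSpace Q] [ChartedSpace (EuclideanSpace ℝ (Fin n)) Q]
    [IsManifold (𝓡 n) ∞ Q]
    (h : Bundle.ContMDiffRiemannianMetric (𝓡 n) ∞ (EuclideanSpace ℝ (Fin n))
      (fun q : Q ↦ TangentSpace (𝓡 n) q))
    (hQ : WarpedHypersurface.HasConstantSectionalCurvature (𝓡 n) h.inner c)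
    -- the hypersurface: an immersion into `K × Q` with a unit normal field
    {M : Type*} [TopologicalSpace M] [ChartedSpace (EuclideanSpace ℝ (Fin n)) M]
    [IsManifold (𝓡 n) ∞ M]
    {χ : M → ℝ × Q} (hχK : ∀ x, (χ x).1 ∈ K)
    (hχ : ContMDiff (𝓡 n) (𝓘(ℝ, ℝ).prod (𝓡 n)) ∞ χ)
    (himm : ∀ x, Function.Injective (mfderiv (𝓡 n) (𝓘(ℝ, ℝ).prod (𝓡 n)) χ x))
    {ν : ∀ x : M, TangentSpace (𝓘(ℝ, ℝ).prod (𝓡 n)) (χ x)}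
    (hν : WarpedHypersurface.IsUnitNormal (𝓡 n) (𝓘(ℝ, ℝ).prod (𝓡 n))
      (WarpedHypersurface.warpedMetric (𝓡 n) f h.inner) χ ν)
    -- the induced metric is Einstein
    {ρ : ℝ}
    (hE : WarpedHypersurface.IsEinstein (𝓡 n)
      (WarpedHypersurface.inducedMetric (𝓡 n) (𝓘(ℝ, ℝ).prod (𝓡 n))
        (WarpedHypersurface.warpedMetric (𝓡 n) f h.inner) χ) ρ)
    (x₀ : M) :
    let J := 𝓘(ℝ, ℝ).prod (𝓡 n)
    let gbar := WarpedHypersurface.warpedMetric (𝓡 n) f h.inner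
    let g := WarpedHypersurface.inducedMetric (𝓡 n) J gbar χ
    let A : Module.End ℝ (TangentSpace (𝓡 n) x₀) :=
      (WarpedHypersurface.shapeOperator (𝓡 n) J gbar χ ν x₀).toLinearMap
    let H : ℝ := WarpedHypersurface.meanCurvature (𝓡 n) J gbar χ ν x₀
    let T : TangentSpace (𝓡 n) x₀ :=
      WarpedHypersurface.tangentialPart (𝓡 n) J gbar χ x₀ (WarpedHypersurface.dt (𝓡 n) (χ x₀))
    let a : ℝ := WarpedHypersurface.coeffA f c (χ x₀).1
    let b : ℝ := WarpedHypersurface.coeffB f c (χ x₀).1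
    T ≠ 0 → b ≠ 0 →
      ∃ lam₁ lam₂ lamn : ℝ,
        A.HasEigenvector lamn T ∧
        {μ : ℝ | A.HasEigenvalue μ} = {lam₁, lam₂, lamn} ∧
        lam₁ ≠ lamn ∧ lam₂ ≠ lamn ∧
        2 ≤ {μ : ℝ | A.HasEigenvalue μ}.ncard ∧ {μ : ℝ | A.HasEigenvalue μ}.ncard ≤ 3 ∧
        lam₁ ^ 2 - n * H * lam₁ + ρ + (n - 1) * a + g x₀ T T * b = 0 ∧
        lam₂ ^ 2 - n * H * lam₂ + ρ + (n - 1) * a + g x₀ T T * b = 0 ∧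
        lamn ^ 2 - n * H * lamn + ρ + (n - 1) * (a + g x₀ T T * b) = 0 ∧
        Module.finrank ℝ (A.eigenspace lamn) = 1 := by
  intro J gbar g A H T a b hT hb
  obtain ⟨hpos, hadj, hric⟩ := WarpedHypersurface.ricci_warped hK hf hfpos h hQ hχK hχ himm hν x₀
    rfl rfl rfl
  have hfin : Module.finrank ℝ (EuclideanSpace ℝ (Fin n)) = n := finrank_euclideanSpace_fin
  have hn0 : (n : ℝ) ≠ 0 := by positivity
  have hH : n * H = LinearMap.trace ℝ (TangentSpace (𝓡 n) x₀) A := by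
    change (n : ℝ) * (1 / (Module.finrank ℝ (EuclideanSpace ℝ (Fin n)) : ℝ) *
      LinearMap.trace ℝ (TangentSpace (𝓡 n) x₀) A) = _
    rw [hfin]
    field_simp
  rw [hfin] at hric
  rw [hH]
  exact WarpedHypersurface.exists_principal_curvatures (by omega) hfin hpos hadj hT hb
    fun w z ↦ (hric w z).symm.trans (hE x₀ w z)
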